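/- Conventions. Products $\times$ and smash products $\wedge$ are formed in compactly generated spaces (the product carries the compactly generated topology associated with the product topology, and $A\wedge B=(A\times B)/(A\vee B)$); maps and homotopies are pointed, and $[Y,X]$ is the set of pointed homotopy classes. Let $\Gamma$ be a co-grouplike space, i.e. a pointed space with a co-multiplication $\Gamma\to\Gamma\vee\Gamma$ which, up to homotopy, is co-unital, co-associative and has a co-inverse. Write $\Gamma A=\Gamma\wedge A$; it is again co-grouplike, so $[\Gamma A,X]$ is a group. For a space $W$ put $\tau^\Gamma_W(X)=[\Gamma(W\sqcup *),X]$. Write $(x,y)=xyx^{-1}y^{-1}$ and $x^y=yxy^{-1}$ in a group; group operations are written multiplicatively. Let $A,B,C$ be pointed spaces with the pointed homotopy type of well-pointed compactly generated Hausdorff spaces, $X$ a pointed space, and $\alpha\in[\Gamma A,X]$, $\beta\in[\Gamma B,X]$, $\gamma\in[\Gamma C,X]$. The $\Gamma$-Whitehead product $[\alpha,\beta]_\Gamma\in[\Gamma(A\wedge B),X]$ is the class whose image in $[\Gamma(A\times B),X]$ is the commutator $(p_A^*\alpha,p_B^*\beta)$, where $p_A,p_B$ are induced by the projections. For $a\in\tau^\Gamma_A(X)$,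 $b\in\tau^\Gamma_B(X)$, the product $[a,b]_\Gamma$ is regarded as an element of $\tau^\Gamma_{A\times B}(X)$ through $(A\sqcup *)\wedge(B\sqcup *)\cong(A\times B)\sqcup *$. For $\xi\in[\Gamma,X]=[\Gamma S^0,X]$ and $\eta\in[\Gamma W,X]$, $\eta^\xi\in[\Gamma W,X]$ is the class whose image in $\tau^\Gamma_W(X)$ is $\xi\eta\xi^{-1}$; here $[\Gamma,X]$ and $[\Gamma W,X]$ are mapped to $\tau^\Gamma_W(X)$ through $W\sqcup *\to S^0$ and $W\sqcup *\to W$. For $\xi\in[\Gamma V,X]$ put $\xi\cdot\eta=\eta^\xi$ if $V\cong S^0$ (so that $\Gamma V=\Gamma$ and $\xi\in[\Gamma,X]$), and $\xi\cdot\eta=\eta$ otherwise. For $i,j,k$ a permutation of $1,2,3$, let $t_{ijk}$ be the map that permutes three factors, of a product or of a smash product, $x_1,x_2,x_3\mapsto x_i,x_j,x_k$. Theorem. (0) These are well defined: for pointed spaces $P,Q,W$ with the pointed homotopy type of well-pointed compactly generated Hausdorff spaces, $P\wedge Q$ is again of this kind, there is exactly one class $[\mu,\nu]_\Gamma$ for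 all $\mu\in[\Gamma P,X]$, $\nu\in[\Gamma Q,X]$, and there is exactly one class $\eta^\xi$ for all $\xi\in[\Gamma,X]$, $\eta\in[\Gamma W,X]$. (1) Let $a,b,c$ be the images of $\alpha,\beta,\gamma$ in $\tau^\Gamma_A(X),\tau^\Gamma_B(X),\tau^\Gamma_C(X)$, and $\bar\alpha,\bar\beta,\bar\gamma$ their images in $\tau^\Gamma_{A\times B\times C}(X)$. Then in $\tau^\Gamma_{A\times B\times C}(X)$ $$\big((\Gamma t_{213})^*[[b^{-1},a]_\Gamma,c]_\Gamma\big)^{\bar\beta}\,\big((\Gamma t_{321})^*[[c^{-1},b]_\Gamma,a]_\Gamma\big)^{\bar\gamma}\,\big((\Gamma t_{132})^*[[a^{-1},c]_\Gamma,b]_\Gamma\big)^{\bar\alpha}=1,$$ and $[[b^{-1},a]_\Gamma,c]_\Gamma$, $[[c^{-1},b]_\Gamma,a]_\Gamma$, $[[a^{-1},c]_\Gamma,b]_\Gamma$ are the images in $\tau^\Gamma_{B\times A\times C}(X)$, $\tau^\Gamma_{C\times B\times A}(X)$, $\tau^\Gamma_{A\times C\times B}(X)$ of $[[\beta^{-1},\alpha]_\Gamma,\gamma]_\Gamma$,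 $[[\gamma^{-1},\beta]_\Gamma,\alpha]_\Gamma$, $[[\alpha^{-1},\gamma]_\Gamma,\beta]_\Gamma$. (2) If $\Gamma A$, $\Gamma B$ and $\Gamma C$ are homotopy co-commutative, then in $[\Gamma(A\wedge B\wedge C),X]$ (where the operation is usually written additively) $$[[\alpha,\beta]_\Gamma,\gamma]_\Gamma\cdot(\Gamma t_{312})^*[[\gamma,\alpha]_\Gamma,\beta]_\Gamma\cdot(\Gamma t_{231})^*[[\beta,\gamma]_\Gamma,\alpha]_\Gamma=1.$$ (3) If each of $A,B,C$ is homeomorphic, as a pointed space, to $S^0$ or has a homotopy co-commutative $\Gamma A$, respectively $\Gamma B$, $\Gamma C$, then in $[\Gamma(A\wedge B\wedge C),X]$ $$(\Gamma t_{213})^*\big(\beta\cdot[[\beta^{-1},\alpha]_\Gamma,\gamma]_\Gamma\big)\;(\Gamma t_{321})^*\big(\gamma\cdot[[\gamma^{-1},\beta]_\Gamma,\alpha]_\Gamma\big)\;(\Gamma t_{132})^*\big(\alpha\cdot[[\alpha^{-1},\gamma]_\Gamma,\beta]_\Gamma\big)=1.$$ -/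

import Mathlib

universe u v w

namespace GammaFox

open TopologicalSpace unitInterval

/-! ## Pointed spaces, pointed maps, pointed homotopy classes -/

/-- A topological space with a base point. -/
structure PTop : Type (u + 1) where
  carrier : Type u
  [top : TopologicalSpace carrier]
  pt : carrier

instance : CoeSort PTop.{u} (Type u) := ⟨PTop.carrier⟩

instance (X : PTop.{u}) : TopologicalSpace X := X.top

/-- Base point preserving continuous maps. -/
@[ext]
structure PMap (X : PTop.{u}) (Y : PTop.{v}) where
  toMap : C(X, Y)
  map_pt : toMap X.pt = Y.pt

instance (X : PTop.{u}) (Y : PTop.{v}) : CoeFun (PMap X Y) (fun _ => X → Y) :=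
  ⟨fun f => f.toMap⟩

namespace PMap

variable {X : PTop.{u}} {Y : PTop.{v}} {Z : PTop.{w}}

theorem ext_fun {f g : PMap X Y} (h : ∀ x, f x = g x) : f = g :=
  PMap.ext (ContinuousMap.ext h)

theorem cont (f : PMap X Y) : Continuous f := f.toMap.continuous

/-- The identity. -/
def id (X : PTop.{u}) : PMap X X := ⟨ContinuousMap.id X, rfl⟩

/-- Composition, `(g.comp f) x = g (f x)`. -/
def comp (g : PMap Y Z) (f : PMap X Y) : PMap X Z :=
  ⟨g.toMap.comp f.toMap, by
    show g (f X.pt) = Z.pt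
    rw [f.map_pt, g.map_pt]⟩

/-- The constant map at the base point. -/
def const (X : PTop.{u}) (Y : PTop.{v}) : PMap X Y :=
  ⟨ContinuousMap.const X Y.pt, rfl⟩

/-- Homotopy of pointed maps through pointed maps. -/
def Homotopic (f g : PMap X Y) : Prop :=
  ContinuousMap.HomotopicRel f.toMap g.toMap {X.pt}

theorem homotopic_iff {f g : PMap X Y} :
    f.Homotopic g ↔ ∃ H : I × X → Y, Continuous H ∧ (∀ x, H (0, x) = f x) ∧
      (∀ x, H (1, x) = g x) ∧ ∀ t, H (t, X.pt) = Y.pt := by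
  constructor
  · rintro ⟨H⟩
    refine ⟨H, H.continuous, fun x => H.apply_zero x, fun x => H.apply_one x, fun t => ?_⟩
    rw [H.eq_fst t rfl]
    exact f.map_pt
  · rintro ⟨H, hc, h0, h1, hp⟩
    refine ⟨⟨⟨⟨H, hc⟩, h0, h1⟩, ?_⟩⟩
    rintro t x rfl
    exact (hp t).trans f.map_pt.symm

theorem Homotopic.refl (f : PMap X Y) : f.Homotopic f :=
  ContinuousMap.HomotopicRel.refl f.toMap

theorem Homotopic.comp {f f' : PMap X Y} {g g' : PMap Y Z} (hg : g.Homotopic g')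
    (hf : f.Homotopic f') : (g.comp f).Homotopic (g'.comp f') := by
  obtain ⟨H, hH, h0, h1, hp⟩ := homotopic_iff.1 hf
  obtain ⟨K, hK, k0, k1, kp⟩ := homotopic_iff.1 hg
  refine homotopic_iff.2 ⟨fun p => K (p.1, H p), by fun_prop, fun x => ?_, fun x => ?_,
    fun t => ?_⟩
  · show K (0, H (0, x)) = _
    rw [h0, k0]; rfl
  · show K (1, H (1, x)) = _
    rw [h1, k1]; rfl
  · show K (t, H (t, X.pt)) = _
    rw [hp, kp]

instance setoid (X : PTop.{u}) (Y : PTop.{v}) : Setoid (PMap X Y) where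
  r := Homotopic
  iseqv := ⟨fun f => ContinuousMap.HomotopicRel.refl f.toMap,
    fun h => ContinuousMap.HomotopicRel.symm h,
    fun h k => ContinuousMap.HomotopicRel.trans h k⟩

end PMap

/-- The set `[X, Y]` of pointed homotopy classes of pointed maps. -/
def HClass (X : PTop.{u}) (Y : PTop.{v}) : Type (max u v) := Quotient (PMap.setoid X Y)

/-- The map `f^* : [Y, Z] → [X, Z]` given by precomposition with `f : X → Y`. -/
def HClass.pull {X : PTop.{u}} {Y : PTop.{v}} {Z : PTop.{w}} (f : PMap X Y) :
    HClass Y Z → HClass X Z :=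
  Quotient.map (fun g => g.comp f) (fun _ _ h => h.comp (PMap.Homotopic.refl f))

/-- Having the same pointed homotopy type. -/
def PHomotopyEquivalent (X : PTop.{u}) (Y : PTop.{v}) : Prop :=
  ∃ (f : PMap X Y) (g : PMap Y X),
    (g.comp f).Homotopic (PMap.id X) ∧ (f.comp g).Homotopic (PMap.id Y)

/-- Well-pointed: the base point is closed and its inclusion is a cofibration, i.e. the subspace
`X × {0} ∪ {pt} × [0, 1]` is a retract of the cylinder `X × [0, 1]`. -/
def WellPointed (X : PTop.{u}) : Prop :=
  IsClosed ({X.pt} : Set X) ∧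
    ∃ r : C(X × I, X × I), (∀ p, (r p).2 = 0 ∨ (r p).1 = X.pt) ∧
      ∀ p : X × I, p.2 = 0 ∨ p.1 = X.pt → r p = p

/-- The pointed space has the pointed homotopy type of a well-pointed compactly generated
Hausdorff space. -/
def HasCGHType (X : PTop.{u}) : Prop :=
  ∃ Y : PTop.{u}, T2Space Y ∧ CompactlyGeneratedSpace Y ∧ WellPointed Y ∧
    PHomotopyEquivalent X Y

/-! ## Wedges and co-grouplike spaces -/

section Wedge

variable {X X' Y Y' : PTop.{u}} {Z : PTop.{v}}

/-- The wedge `X ∨ Y`, as the subspace of `X × Y` of the points with at least one coordinate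
at the base point (for two spaces this is homeomorphic to the quotient of the disjoint union
that identifies the base points). -/
def wedge (X Y : PTop.{u}) : PTop.{u} :=
  ⟨{p : X × Y // p.1 = X.pt ∨ p.2 = Y.pt}, ⟨(X.pt, Y.pt), Or.inl rfl⟩⟩

/-- The pinch onto the first summand. -/
def wedgeFst (X Y : PTop.{u}) : PMap (wedge X Y) X :=
  ⟨⟨fun p => p.1.1, continuous_fst.comp continuous_subtype_val⟩, rfl⟩

/-- The pinch onto the second summand. -/
def wedgeSnd (X Y : PTop.{u}) : PMap (wedge X Y) Y :=
  ⟨⟨fun p => p.1.2, continuous_snd.comp continuous_subtype_val⟩, rfl⟩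

/-- `f ∨ g`. -/
def wedgeMap (f : PMap X X') (g : PMap Y Y') : PMap (wedge X Y) (wedge X' Y') :=
  ⟨⟨fun p => ⟨(f p.1.1, g p.1.2), p.2.imp (fun h => by
      show f p.1.1 = _
      rw [h, f.map_pt]) (fun h => by
      show g p.1.2 = _
      rw [h, g.map_pt])⟩,
    Continuous.subtype_mk ((f.cont.comp (continuous_fst.comp continuous_subtype_val)).prodMk
      (g.cont.comp (continuous_snd.comp continuous_subtype_val))) _⟩,
    Subtype.ext (Prod.ext f.map_pt g.map_pt)⟩

/-- The interchange of the two summands. -/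
def wedgeSwap (X Y : PTop.{u}) : PMap (wedge X Y) (wedge Y X) :=
  ⟨⟨fun p => ⟨(p.1.2, p.1.1), p.2.symm⟩,
    Continuous.subtype_mk ((continuous_snd.comp continuous_subtype_val).prodMk
      (continuous_fst.comp continuous_subtype_val)) _⟩, rfl⟩

/-- `(X ∨ X) ∨ X → X ∨ (X ∨ X)`. -/
def wedgeAssoc (X : PTop.{u}) : PMap (wedge (wedge X X) X) (wedge X (wedge X X)) :=
  ⟨⟨fun p => ⟨(p.1.1.1.1, ⟨(p.1.1.1.2, p.1.2), by
      rcases p.2 with h | h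
      · exact Or.inl (congrArg (fun q : wedge X X => q.1.2) h)
      · exact Or.inr h⟩), by
      rcases p.2 with h | h
      · exact Or.inl (congrArg (fun q : wedge X X => q.1.1) h)
      · rcases p.1.1.2 with h' | h'
        · exact Or.inl h'
        · exact Or.inr (Subtype.ext (Prod.ext h' h))⟩, by
      refine Continuous.subtype_mk (Continuous.prodMk ?_ (Continuous.subtype_mk
        (Continuous.prodMk ?_ ?_) _)) _
      · exact continuous_fst.comp (continuous_subtype_val.comp
          (continuous_fst.comp continuous_subtype_val))
      · exact continuous_snd.comp (continuous_subtype_val.comp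
          (continuous_fst.comp continuous_subtype_val))
      · exact continuous_snd.comp continuous_subtype_val⟩, rfl⟩

open Classical in
/-- The underlying function of the folding map: `(x, *) ↦ x`, `(*, y) ↦ y`. -/
noncomputable def foldFun (Z : PTop.{v}) (p : wedge Z Z) : Z :=
  if p.1.2 = Z.pt then p.1.1 else p.1.2

theorem foldFun_fst {p : wedge Z Z} (h : p.1.1 = Z.pt) : foldFun Z p = p.1.2 := by
  unfold foldFun
  split_ifs with h'
  · rw [h, h']
  · rfl

theorem foldFun_snd {p : wedge Z Z} (h : p.1.2 = Z.pt) : foldFun Z p = p.1.1 := if_pos h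

theorem continuous_foldFun (Z : PTop.{v}) : Continuous (foldFun Z) := by
  have c1 : Continuous fun p : wedge Z Z => p.1.1 := (wedgeFst Z Z).cont
  have c2 : Continuous fun p : wedge Z Z => p.1.2 := (wedgeSnd Z Z).cont
  refine continuous_iff_continuousAt.2 fun p => ?_
  refine tendsto_nhds.2 fun U hU hp => ?_
  by_cases hz : Z.pt ∈ U
  · have h1 : p.1.1 ∈ U := by
      rcases p.2 with h | h
      · rw [h]; exact hz
      · rw [← foldFun_snd h]; exact hp
    have h2 : p.1.2 ∈ U := by
      rcases p.2 with h | h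
      · rw [← foldFun_fst h]; exact hp
      · rw [h]; exact hz
    filter_upwards [(hU.preimage c1).mem_nhds h1, (hU.preimage c2).mem_nhds h2] with q q1 q2
    rcases q.2 with h | h
    · show foldFun Z q ∈ U
      rw [foldFun_fst h]; exact q2
    · show foldFun Z q ∈ U
      rw [foldFun_snd h]; exact q1
  · rcases p.2 with h | h
    · have h2 : p.1.2 ∈ U := by rw [← foldFun_fst h]; exact hp
      filter_upwards [(hU.preimage c2).mem_nhds h2] with q q2
      rcases q.2 with h | h
      · show foldFun Z q ∈ U
        rw [foldFun_fst h]; exact q2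
      · exact absurd (h ▸ q2 : Z.pt ∈ U) hz
    · have h1 : p.1.1 ∈ U := by rw [← foldFun_snd h]; exact hp
      filter_upwards [(hU.preimage c1).mem_nhds h1] with q q1
      rcases q.2 with h | h
      · exact absurd (h ▸ q1 : Z.pt ∈ U) hz
      · show foldFun Z q ∈ U
        rw [foldFun_snd h]; exact q1

/-- The folding map `Z ∨ Z → Z`. -/
noncomputable def fold (Z : PTop.{v}) : PMap (wedge Z Z) Z :=
  ⟨⟨foldFun Z, continuous_foldFun Z⟩, foldFun_fst rfl⟩

end Wedge

/-- A co-grouplike space: a pointed space with a co-multiplication that is co-unital,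
co-associative and has a co-inverse, each up to pointed homotopy. -/
class CoGroup (Z : PTop.{u}) where
  /-- the co-multiplication -/
  comul : PMap Z (wedge Z Z)
  /-- the co-inverse -/
  coinv : PMap Z Z
  counit_left : ((wedgeSnd Z Z).comp comul).Homotopic (PMap.id Z)
  counit_right : ((wedgeFst Z Z).comp comul).Homotopic (PMap.id Z)
  coassoc : ((wedgeAssoc Z).comp ((wedgeMap comul (PMap.id Z)).comp comul)).Homotopic
    ((wedgeMap (PMap.id Z) comul).comp comul)
  coinv_left : ((fold Z).comp ((wedgeMap coinv (PMap.id Z)).comp comul)).Homotopic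
    (PMap.const Z Z)
  coinv_right : ((fold Z).comp ((wedgeMap (PMap.id Z) coinv).comp comul)).Homotopic
    (PMap.const Z Z)

/-- Homotopy co-commutativity of the co-multiplication. -/
def HomotopyCocommutative (Z : PTop.{u}) [CoGroup Z] : Prop :=
  ((wedgeSwap Z Z).comp (CoGroup.comul (Z := Z))).Homotopic (CoGroup.comul (Z := Z))

/-! ### The group `[Z, X]` for a co-grouplike space `Z` -/

section Group

variable {Z Z' : PTop.{u}} {X Y : PTop.{v}}

/-- `(f, g) : Z ∨ Z' → X`, equal to `f` on `Z` and to `g` on `Z'`. -/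
noncomputable def copairFun (f : Z → X) (g : Z' → X) (hf : f Z.pt = X.pt) (hg : g Z'.pt = X.pt)
    (p : wedge Z Z') : X :=
  foldFun X ⟨(f p.1.1, g p.1.2), p.2.imp (fun h => by show f p.1.1 = _; rw [h, hf])
    (fun h => by show g p.1.2 = _; rw [h, hg])⟩

/-- `(f, g) : Z ∨ Z' → X`, equal to `f` on `Z` and to `g` on `Z'`. -/
noncomputable def copair (f : PMap Z X) (g : PMap Z' X) : PMap (wedge Z Z') X :=
  ⟨⟨copairFun f g f.map_pt g.map_pt, (continuous_foldFun X).comp (Continuous.subtype_mk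
    ((f.cont.comp (wedgeFst Z Z').cont).prodMk (g.cont.comp (wedgeSnd Z Z').cont)) _)⟩,
    (foldFun_fst f.map_pt).trans g.map_pt⟩

theorem copair_left (f : PMap Z X) (g : PMap Z' X) {p : wedge Z Z'} (h : p.1.2 = Z'.pt) :
    copair f g p = f p.1.1 :=
  foldFun_snd (by show g p.1.2 = _; rw [h, g.map_pt])

theorem copair_right (f : PMap Z X) (g : PMap Z' X) {p : wedge Z Z'} (h : p.1.1 = Z.pt) :
    copair f g p = g p.1.2 :=
  foldFun_fst (by show f p.1.1 = _; rw [h, f.map_pt])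

theorem copair_const_left (g : PMap Z' X) (p : wedge Z Z') :
    copair (PMap.const Z X) g p = g p.1.2 := foldFun_fst rfl

theorem copair_const_right (f : PMap Z X) (p : wedge Z Z') :
    copair f (PMap.const Z' X) p = f p.1.1 := foldFun_snd rfl

theorem copair_homotopic {f f' : PMap Z X} {g g' : PMap Z' X} (hf : f.Homotopic f')
    (hg : g.Homotopic g') : (copair f g).Homotopic (copair f' g') := by
  obtain ⟨H, hH, h0, h1, hp⟩ := PMap.homotopic_iff.1 hf
  obtain ⟨K, hK, k0, k1, kp⟩ := PMap.homotopic_iff.1 hg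
  have c1 := (wedgeFst Z Z').cont
  have c2 := (wedgeSnd Z Z').cont
  refine PMap.homotopic_iff.2 ⟨fun p => copairFun (fun x => H (p.1, x)) (fun x => K (p.1, x))
    (hp _) (kp _) p.2, ?_, fun x => ?_, fun x => ?_, fun t => ?_⟩
  · exact (continuous_foldFun X).comp (Continuous.subtype_mk
      ((hH.comp (continuous_fst.prodMk (c1.comp continuous_snd))).prodMk
        (hK.comp (continuous_fst.prodMk (c2.comp continuous_snd)))) _)
  · exact congrArg (foldFun X) (Subtype.ext (Prod.ext (h0 _) (k0 _)))
  · exact congrArg (foldFun X) (Subtype.ext (Prod.ext (h1 _) (k1 _)))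
  · exact (foldFun_fst (hp t)).trans (kp t)

theorem const_comp (f : PMap Z X) : f.comp (PMap.const Z Z) = PMap.const Z X :=
  PMap.ext_fun fun _ => f.map_pt

variable [CoGroup Z]

/-- The product of two maps, `Z → Z ∨ Z → X`. -/
noncomputable def mulMap (f g : PMap Z X) : PMap Z X := (copair f g).comp CoGroup.comul

theorem mulMap_homotopic {f f' g g' : PMap Z X} (hf : f.Homotopic f') (hg : g.Homotopic g') :
    (mulMap f g).Homotopic (mulMap f' g') :=
  (copair_homotopic hf hg).comp (PMap.Homotopic.refl _)

theorem mulMap_assoc (f g h : PMap Z X) :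
    (mulMap (mulMap f g) h).Homotopic (mulMap f (mulMap g h)) := by
  have key := (PMap.Homotopic.refl (copair f (copair g h))).comp (CoGroup.coassoc (Z := Z))
  have e1 : (copair f (copair g h)).comp ((wedgeAssoc Z).comp
      ((wedgeMap CoGroup.comul (PMap.id Z)).comp CoGroup.comul)) = mulMap (mulMap f g) h := by
    refine PMap.ext_fun fun z => ?_
    show (copair f (copair g h)) (wedgeAssoc Z (wedgeMap CoGroup.comul (PMap.id Z)
      (CoGroup.comul z))) = copair (mulMap f g) h (CoGroup.comul z)
    generalize (CoGroup.comul z : wedge Z Z) = p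
    rcases p.2 with hp | hp
    · rw [copair_right (mulMap f g) h hp]
      have e : (CoGroup.comul p.1.1 : wedge Z Z) = (wedge Z Z).pt := by
        rw [hp, PMap.map_pt]
      rw [copair_right]
      · exact copair_right g h (congrArg (fun q : wedge Z Z => q.1.2) e)
      · exact congrArg (fun q : wedge Z Z => q.1.1) e
    · rw [copair_left (mulMap f g) h hp]
      show _ = copair f g (CoGroup.comul p.1.1)
      rcases (CoGroup.comul p.1.1 : wedge Z Z).2 with hq | hq
      · rw [copair_right _ _ hq, copair_right f _ (by exact hq)]
        exact copair_left g h hp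
      · rw [copair_left _ _ hq]
        exact copair_left f _ (Subtype.ext (Prod.ext hq hp))
  have e2 : (copair f (copair g h)).comp ((wedgeMap (PMap.id Z) CoGroup.comul).comp
      CoGroup.comul) = mulMap f (mulMap g h) := by
    refine PMap.ext_fun fun z => ?_
    rfl
  rw [e1, e2] at key
  exact key

theorem const_mulMap (f : PMap Z X) : (mulMap (PMap.const Z X) f).Homotopic f := by
  have key := (PMap.Homotopic.refl f).comp (CoGroup.counit_left (Z := Z))
  have e : f.comp ((wedgeSnd Z Z).comp CoGroup.comul) = mulMap (PMap.const Z X) f :=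
    PMap.ext_fun fun z => (copair_const_left f _).symm
  rw [e] at key
  exact key

theorem mulMap_const (f : PMap Z X) : (mulMap f (PMap.const Z X)).Homotopic f := by
  have key := (PMap.Homotopic.refl f).comp (CoGroup.counit_right (Z := Z))
  have e : f.comp ((wedgeFst Z Z).comp CoGroup.comul) = mulMap f (PMap.const Z X) :=
    PMap.ext_fun fun z => (copair_const_right f _).symm
  rw [e] at key
  exact key

theorem comp_fold (f : PMap Z X) (a b : PMap Z Z) :
    f.comp ((fold Z).comp ((wedgeMap a b).comp CoGroup.comul)) =
      mulMap (f.comp a) (f.comp b) := by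
  refine PMap.ext_fun fun z => ?_
  show f (foldFun Z (wedgeMap a b (CoGroup.comul z))) =
    copair (f.comp a) (f.comp b) (CoGroup.comul z)
  generalize (CoGroup.comul z : wedge Z Z) = p
  rcases p.2 with hp | hp
  · rw [copair_right _ _ hp, foldFun_fst]
    · rfl
    · show a p.1.1 = _
      rw [hp, a.map_pt]
  · rw [copair_left _ _ hp, foldFun_snd]
    · rfl
    · show b p.1.2 = _
      rw [hp, b.map_pt]

theorem inv_mulMap (f : PMap Z X) :
    (mulMap (f.comp CoGroup.coinv) f).Homotopic (PMap.const Z X) := by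
  have key := (PMap.Homotopic.refl f).comp (CoGroup.coinv_left (Z := Z))
  rw [comp_fold, const_comp] at key
  exact key

/-- The group structure on `[Z, X]` induced by the co-multiplication and the co-inverse of `Z`. -/
noncomputable instance : Group (HClass Z X) where
  mul := Quotient.map₂ mulMap fun _ _ h _ _ k => mulMap_homotopic h k
  one := Quotient.mk _ (PMap.const Z X)
  inv := HClass.pull CoGroup.coinv
  mul_assoc := by
    rintro ⟨f⟩ ⟨g⟩ ⟨h⟩
    exact Quotient.sound (mulMap_assoc f g h)
  one_mul := by
    rintro ⟨f⟩
    exact Quotient.sound (const_mulMap f)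
  mul_one := by
    rintro ⟨f⟩
    exact Quotient.sound (mulMap_const f)
  inv_mul_cancel := by
    rintro ⟨f⟩
    exact Quotient.sound (inv_mulMap f)

end Group

/-! ## Products and smash products of compactly generated spaces -/

section KProd

/-- The product in compactly generated spaces: the set `X × Y` with the compactly generated
topology associated with the product topology. -/
def KProd (X Y : Type u) : Type u := X × Y

/-- The point `(x, y)` of the product. -/
def KProd.mk {X Y : Type u} (x : X) (y : Y) : KProd X Y := (x, y)

instance (X Y : Type u) [TopologicalSpace X] [TopologicalSpace Y] :
    TopologicalSpace (KProd X Y) :=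
  TopologicalSpace.compactlyGenerated.{u} (X × Y)

variable {X Y : Type u} [TopologicalSpace X] [TopologicalSpace Y]

theorem KProd.continuous_dom {T : Type v} [TopologicalSpace T] {f : KProd X Y → T}
    (h : ∀ (S : Type u) [TopologicalSpace S] [CompactSpace S] [T2Space S] (a : S → X)
      (b : S → Y), Continuous a → Continuous b → Continuous fun s => f (KProd.mk (a s) (b s))) :
    Continuous f :=
  continuous_from_compactlyGenerated.{u} (X := X × Y) f fun S g =>
    h S (fun s => (g s).1) (fun s => (g s).2) (by fun_prop) (by fun_prop)

theorem KProd.continuous_test {S : Type u} [TopologicalSpace S] [CompactSpace S] [T2Space S]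
    {a : S → X} {b : S → Y} (ha : Continuous a) (hb : Continuous b) :
    Continuous fun s => KProd.mk (a s) (b s) := by
  refine continuous_def.2 fun U hU => ?_
  exact (isOpen_sigma_iff.1 (isOpen_coinduced.1 hU))
    ⟨CompHaus.of S, ⟨fun s => (a s, b s), ha.prodMk hb⟩⟩

theorem KProd.continuous_fst : Continuous (fun p : KProd X Y => p.1) :=
  KProd.continuous_dom fun _ _ _ _ _ _ ha _ => ha

theorem KProd.continuous_snd : Continuous (fun p : KProd X Y => p.2) :=
  KProd.continuous_dom fun _ _ _ _ _ _ _ hb => hb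

instance : UCompactlyGeneratedSpace.{u} (KProd X Y) :=
  uCompactlyGeneratedSpace_of_continuous_maps.{u} fun _ h =>
    KProd.continuous_dom fun S _ _ _ _ _ ha hb =>
      h (CompHaus.of S) ⟨_, KProd.continuous_test ha hb⟩

theorem KProd.continuous_mk {T : Type v} [TopologicalSpace T] [UCompactlyGeneratedSpace.{u} T]
    {a : T → X} {b : T → Y} (ha : Continuous a) (hb : Continuous b) :
    Continuous fun t => KProd.mk (a t) (b t) :=
  continuous_from_uCompactlyGeneratedSpace.{u} _ fun S g =>
    KProd.continuous_test (S := S) (ha.comp g.continuous) (hb.comp g.continuous)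

end KProd

section Smash

variable {A B C A' B' : PTop.{u}}

/-- The product of pointed spaces. -/
def prod (A B : PTop.{u}) : PTop.{u} := ⟨KProd A B, KProd.mk A.pt B.pt⟩

/-- The relation on `A × B` that identifies all points of `A ∨ B`. -/
def smashSetoid (A B : PTop.{u}) : Setoid (KProd A B) where
  r p q := p = q ∨ ((p.1 = A.pt ∨ p.2 = B.pt) ∧ (q.1 = A.pt ∨ q.2 = B.pt))
  iseqv := by
    refine ⟨fun _ => Or.inl rfl, ?_, ?_⟩
    · rintro p q (h | h)
      · exact Or.inl h.symm
      · exact Or.inr h.symm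
    · rintro p q r (rfl | h) (rfl | k)
      · exact Or.inl rfl
      · exact Or.inr k
      · exact Or.inr h
      · exact Or.inr ⟨h.1, k.2⟩

/-- The smash product `A ∧ B = (A × B) / (A ∨ B)`. -/
def smash (A B : PTop.{u}) : PTop.{u} :=
  ⟨Quotient (smashSetoid A B), Quotient.mk _ (KProd.mk A.pt B.pt)⟩

/-- The projection `A × B → A ∧ B`. -/
def smashMk (A B : PTop.{u}) : PMap (prod A B) (smash A B) :=
  ⟨⟨Quotient.mk (smashSetoid A B), continuous_quotient_mk'⟩, rfl⟩

instance : UCompactlyGeneratedSpace.{u} (smash A B) :=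
  inferInstanceAs (UCompactlyGeneratedSpace.{u} (Quotient (smashSetoid A B)))

instance : UCompactlyGeneratedSpace.{u} (prod A B) :=
  inferInstanceAs (UCompactlyGeneratedSpace.{u} (KProd A B))

theorem smashMk_eq_pt {p : prod A B} (h : p.1 = A.pt ∨ p.2 = B.pt) :
    smashMk A B p = (smash A B).pt :=
  Quotient.sound (s := smashSetoid A B) (Or.inr ⟨h, Or.inl rfl⟩)

/-- A pointed map on `A × B` that sends `A ∨ B` to the base point induces one on `A ∧ B`. -/
def smashLift {Z : PTop.{v}} (f : PMap (prod A B) Z)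
    (h : ∀ p : prod A B, p.1 = A.pt ∨ p.2 = B.pt → f p = Z.pt) : PMap (smash A B) Z :=
  ⟨⟨Quotient.lift f (by
      rintro p q (rfl | ⟨h1, h2⟩)
      · rfl
      · rw [h p h1, h q h2]), f.cont.quotient_lift _⟩, f.map_pt⟩

/-- The projection `A × B → A`. -/
def prodFst (A B : PTop.{u}) : PMap (prod A B) A := ⟨⟨fun p => p.1, KProd.continuous_fst⟩, rfl⟩

/-- The projection `A × B → B`. -/
def prodSnd (A B : PTop.{u}) : PMap (prod A B) B := ⟨⟨fun p => p.2, KProd.continuous_snd⟩, rfl⟩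

/-- The map `T → A × B` with given components. -/
def prodLift {T : PTop.{v}} [UCompactlyGeneratedSpace.{u} T] (f : PMap T A) (g : PMap T B) :
    PMap T (prod A B) :=
  ⟨⟨fun t => KProd.mk (f t) (g t), KProd.continuous_mk f.cont g.cont⟩, Prod.ext f.map_pt g.map_pt⟩

/-- `f × g`. -/
def prodMap (f : PMap A A') (g : PMap B B') : PMap (prod A B) (prod A' B') :=
  prodLift (f.comp (prodFst A B)) (g.comp (prodSnd A B))

/-- `f ∧ g`. -/
def smashMap (f : PMap A A') (g : PMap B B') : PMap (smash A B) (smash A' B') :=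
  smashLift ((smashMk A' B').comp (prodMap f g)) fun p h =>
    smashMk_eq_pt (h.imp (fun h => by
      show f p.1 = _
      rw [h, f.map_pt]) (fun h => by
      show g p.2 = _
      rw [h, g.map_pt]))

theorem smashMap_homotopic {f f' : PMap A A'} (hf : f.Homotopic f') (g : PMap B B') :
    (smashMap f g).Homotopic (smashMap f' g) := by
  obtain ⟨H, hH, h0, h1, hp⟩ := PMap.homotopic_iff.1 hf
  let F : KProd A B → C(I, smash A' B') := fun p =>
    ⟨fun t => smashMk A' B' (KProd.mk (H (t, p.1)) (g p.2)), (smashMk A' B').cont.comp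
      ((KProd.continuous_test (S := ULift.{u} I) (a := fun t => H (t.down, p.1))
        (b := fun _ => g p.2) (hH.comp (continuous_uliftDown.prodMk continuous_const))
        continuous_const).comp continuous_uliftUp)⟩
  have hF : Continuous F := by
    refine KProd.continuous_dom fun S _ _ _ a b ha hb => ?_
    refine ContinuousMap.continuous_of_continuous_uncurry _ ?_
    exact (smashMk A' B').cont.comp (KProd.continuous_test (S := S × I)
      (a := fun q => H (q.2, a q.1)) (b := fun q => g (b q.1))
      (hH.comp (continuous_snd.prodMk (ha.comp continuous_fst)))
      (g.cont.comp (hb.comp continuous_fst)))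
  have hF0 : ∀ p : KProd A B, (p.1 = A.pt ∨ p.2 = B.pt) →
      F p = ContinuousMap.const I (smash A' B').pt := by
    intro p h
    refine ContinuousMap.ext fun t => smashMk_eq_pt (h.imp (fun h => ?_) (fun h => ?_))
    · show H (t, p.1) = _
      rw [h, hp]
    · show g p.2 = _
      rw [h, g.map_pt]
  let G : smash A B → C(I, smash A' B') := Quotient.lift F (by
    rintro p q (rfl | ⟨k1, k2⟩)
    · rfl
    · rw [hF0 p k1, hF0 q k2])
  have hG : Continuous G := hF.quotient_lift _
  refine PMap.homotopic_iff.2 ⟨fun p => G p.2 p.1, ?_, ?_, ?_, ?_⟩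
  · exact (ContinuousMap.continuous_uncurry_of_continuous ⟨G, hG⟩).comp continuous_swap
  · rintro ⟨p⟩
    show smashMk A' B' (KProd.mk (H (0, p.1)) (g p.2)) = smashMk A' B' (KProd.mk (f p.1) (g p.2))
    rw [h0]
  · rintro ⟨p⟩
    show smashMk A' B' (KProd.mk (H (1, p.1)) (g p.2)) = smashMk A' B' (KProd.mk (f' p.1) (g p.2))
    rw [h1]
  · intro t
    exact congrArg (fun φ : C(I, smash A' B') => φ t) (hF0 (KProd.mk A.pt B.pt) (Or.inl rfl))

/-- The distributivity map `(A ∨ A') ∧ B → (A ∧ B) ∨ (A' ∧ B)`. -/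
def smashDistrib (A A' B : PTop.{u}) :
    PMap (smash (wedge A A') B) (wedge (smash A B) (smash A' B)) :=
  ⟨⟨fun s => ⟨(smashMap (wedgeFst A A') (PMap.id B) s, smashMap (wedgeSnd A A') (PMap.id B) s), by
      induction s using Quotient.inductionOn with
      | h p =>
        exact p.1.2.imp (fun h => smashMk_eq_pt (Or.inl h)) (fun h => smashMk_eq_pt (Or.inl h))⟩,
    Continuous.subtype_mk ((smashMap (wedgeFst A A') (PMap.id B)).cont.prodMk
      (smashMap (wedgeSnd A A') (PMap.id B)).cont) _⟩, rfl⟩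

theorem smashMap_id_comp {D : PTop.{u}} (f : PMap A A') (f' : PMap A' D) :
    smashMap (f'.comp f) (PMap.id B) =
      (smashMap f' (PMap.id B)).comp (smashMap f (PMap.id B)) :=
  PMap.ext_fun (by rintro ⟨p⟩; rfl)

/-- For a co-grouplike space `Γ` and any pointed space `A`, the space `ΓA = Γ ∧ A` is
co-grouplike, with co-multiplication `Γ ∧ A → (Γ ∨ Γ) ∧ A → (Γ ∧ A) ∨ (Γ ∧ A)`. -/
instance instCoGroupSmash (Γ A : PTop.{u}) [CoGroup Γ] : CoGroup (smash Γ A) where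
  comul := (smashDistrib Γ Γ A).comp (smashMap CoGroup.comul (PMap.id A))
  coinv := smashMap CoGroup.coinv (PMap.id A)
  counit_left := by
    have key := smashMap_homotopic (CoGroup.counit_left (Z := Γ)) (PMap.id A)
    convert key using 1 <;> exact PMap.ext_fun (by rintro ⟨p⟩; rfl)
  counit_right := by
    have key := smashMap_homotopic (CoGroup.counit_right (Z := Γ)) (PMap.id A)
    convert key using 1 <;> exact PMap.ext_fun (by rintro ⟨p⟩; rfl)
  coassoc := by
    have key := (PMap.Homotopic.refl ((wedgeMap (PMap.id (smash Γ A)) (smashDistrib Γ Γ A)).comp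
      (smashDistrib Γ (wedge Γ Γ) A))).comp
        (smashMap_homotopic (CoGroup.coassoc (Z := Γ)) (PMap.id A))
    convert key using 1 <;> exact PMap.ext_fun (by rintro ⟨p⟩; rfl)
  coinv_left := by
    have key := smashMap_homotopic (CoGroup.coinv_left (Z := Γ)) (PMap.id A)
    convert key using 1
    · refine PMap.ext_fun ?_
      rintro ⟨p⟩
      show foldFun _ _ = smashMk Γ A (KProd.mk (foldFun Γ _) p.2)
      rcases (CoGroup.comul p.1 : wedge Γ Γ).2 with h | h
      · rw [foldFun_fst, foldFun_fst]
        · rfl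
        · show CoGroup.coinv (CoGroup.comul p.1 : wedge Γ Γ).1.1 = _
          rw [h, PMap.map_pt]
        · refine smashMk_eq_pt (Or.inl ?_)
          show CoGroup.coinv (CoGroup.comul p.1 : wedge Γ Γ).1.1 = _
          rw [h, PMap.map_pt]
      · rw [foldFun_snd, foldFun_snd]
        · rfl
        · exact h
        · exact smashMk_eq_pt (Or.inl h)
    · exact PMap.ext_fun (by rintro ⟨p⟩; exact (smashMk_eq_pt (Or.inl rfl)).symm)
  coinv_right := by
    have key := smashMap_homotopic (CoGroup.coinv_right (Z := Γ)) (PMap.id A)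
    convert key using 1
    · refine PMap.ext_fun ?_
      rintro ⟨p⟩
      show foldFun _ _ = smashMk Γ A (KProd.mk (foldFun Γ _) p.2)
      rcases (CoGroup.comul p.1 : wedge Γ Γ).2 with h | h
      · rw [foldFun_fst, foldFun_fst]
        · rfl
        · exact h
        · exact smashMk_eq_pt (Or.inl h)
      · rw [foldFun_snd, foldFun_snd]
        · rfl
        · show CoGroup.coinv (CoGroup.comul p.1 : wedge Γ Γ).1.2 = _
          rw [h, PMap.map_pt]
        · refine smashMk_eq_pt (Or.inl ?_)
          show CoGroup.coinv (CoGroup.comul p.1 : wedge Γ Γ).1.2 = _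
          rw [h, PMap.map_pt]
    · exact PMap.ext_fun (by rintro ⟨p⟩; exact (smashMk_eq_pt (Or.inl rfl)).symm)

/-- The space `W ⊔ *`, pointed by the added point. -/
def plus (W : Type u) [TopologicalSpace W] : PTop.{u} := ⟨W ⊕ PUnit.{u + 1}, Sum.inr PUnit.unit⟩

/-- The pointed map `W ⊔ * → Z` that extends a continuous map `W → Z`. -/
def plusLift {W : Type u} [TopologicalSpace W] {Z : PTop.{v}} (f : C(W, Z)) : PMap (plus W) Z :=
  ⟨⟨Sum.elim f fun _ => Z.pt, f.continuous.sumElim continuous_const⟩, rfl⟩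

/-- The map `V ⊔ * → W ⊔ *` induced by a continuous map `V → W`. -/
def plusMap {V W : Type u} [TopologicalSpace V] [TopologicalSpace W] (f : C(V, W)) :
    PMap (plus V) (plus W) :=
  plusLift (Z := plus W) ⟨fun v => Sum.inl (f v), continuous_inl.comp f.continuous⟩

/-- The two-point sphere `S⁰`. -/
def S0 : PTop.{u} := plus PUnit.{u + 1}

/-- The pointed space is (homeomorphic to) `S⁰`, so that `ΓW` is `Γ`. -/
def IsS0 (W : PTop.{u}) : Prop := ∃ e : S0.{u} ≃ₜ W, e S0.pt = W.pt

/-! ### Three factors -/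

/-- The projection `(A × B) × C → (A ∧ B) ∧ C`. -/
def smash3Mk (A B C : PTop.{u}) : PMap (prod (prod A B) C) (smash (smash A B) C) :=
  (smashMk (smash A B) C).comp (prodMap (smashMk A B) (PMap.id C))

/-- A pointed map on `(A × B) × C` that sends all points with a coordinate at the base point to
the base point induces a map on `(A ∧ B) ∧ C`. -/
def smash3Lift {Z : PTop.{v}} (f : PMap (prod (prod A B) C) Z)
    (h : ∀ (a : A) (b : B) (c : C), a = A.pt ∨ b = B.pt ∨ c = C.pt →
      f (KProd.mk (KProd.mk a b) c) = Z.pt) :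
    PMap (smash (smash A B) C) Z :=
  smashLift ⟨⟨fun p => Quotient.lift (s := smashSetoid A B) (fun q => f (KProd.mk q p.2)) (by
      rintro p q (rfl | ⟨h1, h2⟩)
      · rfl
      · show f (KProd.mk (KProd.mk p.1 p.2) _) = f (KProd.mk (KProd.mk q.1 q.2) _)
        rw [h _ _ _ (by tauto), h _ _ _ (by tauto)]) p.1, by
      refine KProd.continuous_dom fun S _ _ _ a c ha hc => ?_
      let F : KProd A B → C(S, Z) := fun q =>
        ⟨fun s => f (KProd.mk q (c s)), f.cont.comp (KProd.continuous_test continuous_const hc)⟩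
      have hF : Continuous F := by
        refine KProd.continuous_dom fun T _ _ _ x y hx hy => ?_
        refine ContinuousMap.continuous_of_continuous_uncurry _ ?_
        exact f.cont.comp (KProd.continuous_test (S := T × S)
          (a := fun q => KProd.mk (x q.1) (y q.1)) (b := fun q => c q.2)
          ((KProd.continuous_test hx hy).comp continuous_fst) (hc.comp continuous_snd))
      let G : smash A B → C(S, Z) := Quotient.lift F (by
        rintro p q (rfl | ⟨h1, h2⟩)
        · rfl
        · refine ContinuousMap.ext fun s => ?_
          show f (KProd.mk (KProd.mk p.1 p.2) _) = f (KProd.mk (KProd.mk q.1 q.2) _)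
          rw [h _ _ _ (by tauto), h _ _ _ (by tauto)])
      have hG : Continuous G := hF.quotient_lift _
      have key := (ContinuousMap.continuous_uncurry_of_continuous ⟨G, hG⟩).comp
        (ha.prodMk continuous_id)
      convert key using 1
      funext s
      show Quotient.lift _ _ (a s) = G (a s) s
      induction a s using Quotient.inductionOn with
      | h p => rfl⟩, f.map_pt⟩ (by
      rintro ⟨s, c⟩ hs
      induction s using Quotient.inductionOn with
      | h p =>
        show f (KProd.mk (KProd.mk p.1 p.2) c) = Z.pt
        rcases hs with hs | hs
        · have : (smashSetoid A B).r p (KProd.mk A.pt B.pt) := Quotient.exact hs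
          rcases this with rfl | ⟨h1, -⟩
          · exact h _ _ _ (Or.inl rfl)
          · exact h _ _ _ (by tauto)
        · exact h _ _ _ (Or.inr (Or.inr hs)))

/-- The three coordinates on `(A × B) × C`. -/
def pr1 (A B C : PTop.{u}) : PMap (prod (prod A B) C) A := (prodFst A B).comp (prodFst _ C)
/-- The three coordinates on `(A × B) × C`. -/
def pr2 (A B C : PTop.{u}) : PMap (prod (prod A B) C) B := (prodSnd A B).comp (prodFst _ C)
/-- The three coordinates on `(A × B) × C`. -/
def pr3 (A B C : PTop.{u}) : PMap (prod (prod A B) C) C := prodSnd _ C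

/-- `((a, b), c) ↦ ((b, a), c)`. -/
def t213 (A B C : PTop.{u}) : PMap (prod (prod A B) C) (prod (prod B A) C) :=
  prodLift (prodLift (pr2 A B C) (pr1 A B C)) (pr3 A B C)

/-- `((a, b), c) ↦ ((c, b), a)`. -/
def t321 (A B C : PTop.{u}) : PMap (prod (prod A B) C) (prod (prod C B) A) :=
  prodLift (prodLift (pr3 A B C) (pr2 A B C)) (pr1 A B C)

/-- `((a, b), c) ↦ ((a, c), b)`. -/
def t132 (A B C : PTop.{u}) : PMap (prod (prod A B) C) (prod (prod A C) B) :=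
  prodLift (prodLift (pr1 A B C) (pr3 A B C)) (pr2 A B C)

/-- `((a, b), c) ↦ ((c, a), b)`. -/
def t312 (A B C : PTop.{u}) : PMap (prod (prod A B) C) (prod (prod C A) B) :=
  prodLift (prodLift (pr3 A B C) (pr1 A B C)) (pr2 A B C)

/-- `((a, b), c) ↦ ((b, c), a)`. -/
def t231 (A B C : PTop.{u}) : PMap (prod (prod A B) C) (prod (prod B C) A) :=
  prodLift (prodLift (pr2 A B C) (pr3 A B C)) (pr1 A B C)

theorem smash3Mk_eq_pt {a : A} {b : B} {c : C} (h : a = A.pt ∨ b = B.pt ∨ c = C.pt) :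
    smash3Mk A B C (KProd.mk (KProd.mk a b) c) = (smash (smash A B) C).pt := by
  refine smashMk_eq_pt ?_
  rcases h with h | h | h
  · exact Or.inl (smashMk_eq_pt (Or.inl h))
  · exact Or.inl (smashMk_eq_pt (Or.inr h))
  · exact Or.inr h

/-- `(a ∧ b) ∧ c ↦ (b ∧ a) ∧ c`. -/
def s213 (A B C : PTop.{u}) : PMap (smash (smash A B) C) (smash (smash B A) C) :=
  smash3Lift ((smash3Mk B A C).comp (t213 A B C)) fun _ _ _ h => smash3Mk_eq_pt (by tauto)

/-- `(a ∧ b) ∧ c ↦ (c ∧ b) ∧ a`. -/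
def s321 (A B C : PTop.{u}) : PMap (smash (smash A B) C) (smash (smash C B) A) :=
  smash3Lift ((smash3Mk C B A).comp (t321 A B C)) fun _ _ _ h => smash3Mk_eq_pt (by tauto)

/-- `(a ∧ b) ∧ c ↦ (a ∧ c) ∧ b`. -/
def s132 (A B C : PTop.{u}) : PMap (smash (smash A B) C) (smash (smash A C) B) :=
  smash3Lift ((smash3Mk A C B).comp (t132 A B C)) fun _ _ _ h => smash3Mk_eq_pt (by tauto)

/-- `(a ∧ b) ∧ c ↦ (c ∧ a) ∧ b`. -/
def s312 (A B C : PTop.{u}) : PMap (smash (smash A B) C) (smash (smash C A) B) :=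
  smash3Lift ((smash3Mk C A B).comp (t312 A B C)) fun _ _ _ h => smash3Mk_eq_pt (by tauto)

/-- `(a ∧ b) ∧ c ↦ (b ∧ c) ∧ a`. -/
def s231 (A B C : PTop.{u}) : PMap (smash (smash A B) C) (smash (smash B C) A) :=
  smash3Lift ((smash3Mk B C A).comp (t231 A B C)) fun _ _ _ h => smash3Mk_eq_pt (by tauto)

end Smash

/-! ## The `Γ`-Fox groups and the `Γ`-Whitehead product -/

section Fox

open scoped commutatorElement

variable (Γ : PTop.{u})

/-- The map `(Γf)^* : [ΓB, X] → [ΓA, X]` induced by `f : A → B`. -/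
def gpull {A B : PTop.{u}} {X : PTop.{v}} (f : PMap A B) :
    HClass (smash Γ B) X → HClass (smash Γ A) X :=
  HClass.pull (smashMap (PMap.id Γ) f)

/-- The `Γ`-Fox group `τ^Γ_W(X) = [Γ(W ⊔ *), X]`. -/
abbrev FoxGroup (W : Type u) [TopologicalSpace W] (X : PTop.{v}) : Type (max u v) :=
  HClass (smash Γ (plus W)) X

/-- The map `[ΓZ, X] → τ^Γ_W(X)` induced by a continuous map `W → Z`, through `W ⊔ * → Z`. -/
def toFox {W : Type u} [TopologicalSpace W] {Z : PTop.{u}} {X : PTop.{v}} (f : C(W, Z)) :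
    HClass (smash Γ Z) X → FoxGroup Γ W X :=
  gpull Γ (plusLift f)

variable {Γ} [CoGroup Γ]

/-- `κ ∈ [Γ(A ∧ B), X]` is the class of a map `K' : Γ(A ∧ B) → X` induced by the commutator
`K = f' · g' · f'⁻¹ · g'⁻¹ : Γ(A × B) → X`, where `f'` and `g'` are the composites of
representatives of `α` and `β` with the projections of `Γ(A × B)` to `ΓA` and `ΓB`. -/
def IsGammaWhitehead {A B : PTop.{u}} {X : PTop.{v}} (α : HClass (smash Γ A) X)
    (β : HClass (smash Γ B) X) (κ : HClass (smash Γ (smash A B)) X) : Prop :=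
  gpull Γ (smashMk A B) κ = ⁅gpull Γ (prodFst A B) α, gpull Γ (prodSnd A B) β⁆

open Classical in
/-- The `Γ`-Whitehead product `[α, β]_Γ ∈ [Γ(A ∧ B), X]` (`1` if there is no such class). -/
noncomputable def gammaWhitehead {A B : PTop.{u}} {X : PTop.{v}} (α : HClass (smash Γ A) X)
    (β : HClass (smash Γ B) X) : HClass (smash Γ (smash A B)) X :=
  if h : ∃ κ, IsGammaWhitehead α β κ then h.choose else 1

/-- The map `(A × B) ⊔ * → (A ⊔ *) ∧ (B ⊔ *)`. -/
def plusProd (A B : PTop.{u}) : PMap (plus (prod A B)) (smash (plus A) (plus B)) :=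
  plusLift ⟨fun p => smashMk (plus A) (plus B) (KProd.mk (Sum.inl p.1) (Sum.inl p.2)),
    (smashMk (plus A) (plus B)).cont.comp (KProd.continuous_mk
      (continuous_inl.comp (prodFst A B).cont) (continuous_inl.comp (prodSnd A B).cont))⟩

/-- The `Γ`-Whitehead product `τ^Γ_A(X) × τ^Γ_B(X) → τ^Γ_{A × B}(X)`, through the identification
of `(A ⊔ *) ∧ (B ⊔ *)` with `(A × B) ⊔ *`. -/
noncomputable def foxWhitehead {A B : PTop.{u}} {X : PTop.{v}} (a : FoxGroup Γ A X)
    (b : FoxGroup Γ B X) : FoxGroup Γ (prod A B) X :=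
  gpull Γ (plusProd A B) (gammaWhitehead a b)

/-- `ζ = η^ξ` for `ξ ∈ [Γ, X] = [ΓS⁰, X]` and `η ∈ [ΓW, X]`: in the group `τ^Γ_W(X)`, which contains
`[ΓW, X]` through `W ⊔ * → W` and `[Γ, X]` through `W ⊔ * → S⁰`, one has `ζ = ξ η ξ⁻¹`. -/
def IsConjAct {W : PTop.{u}} {X : PTop.{v}} (ξ : HClass (smash Γ S0) X)
    (η ζ : HClass (smash Γ W) X) : Prop :=
  toFox Γ (ContinuousMap.id W) ζ =
    gpull Γ (plusMap (ContinuousMap.const W PUnit.unit)) ξ * toFox Γ (ContinuousMap.id W) η *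
      (gpull Γ (plusMap (ContinuousMap.const W PUnit.unit)) ξ)⁻¹

open Classical in
/-- The action `η^ξ` of `ξ ∈ [Γ, X] = [ΓS⁰, X]` on `η ∈ [ΓW, X]` (`η` if there is no such
class). -/
noncomputable def conjAct {W : PTop.{u}} {X : PTop.{v}} (ξ : HClass (smash Γ S0) X)
    (η : HClass (smash Γ W) X) : HClass (smash Γ W) X :=
  if h : ∃ ζ, IsConjAct ξ η ζ then h.choose else η

open Classical in
/-- `ξ · η` for `ξ ∈ [ΓV, X]`: it is `η^ξ` if `V` is `S⁰`, so that `ξ ∈ [Γ, X]`, and `η`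
otherwise. -/
noncomputable def dotAct {V W : PTop.{u}} {X : PTop.{v}} (ξ : HClass (smash Γ V) X)
    (η : HClass (smash Γ W) X) : HClass (smash Γ W) X :=
  if h : IsS0 V then
    conjAct (gpull Γ ⟨⟨h.choose, h.choose.continuous⟩, h.choose_spec⟩ ξ) η
  else η

end Fox

end GammaFox

open GammaFox

namespace GammaFox

open TopologicalSpace unitInterval Topology
open scoped commutatorElement

/-! ### Continuity of functions on compactly generated spaces times an interval -/

/-! All the identities are the Hall-Witt identity (`hall_witt`), valid in every group. It is applied
to the pullbacks of `α`, `β`, `γ` along the coordinate projections, in the group of classes on `Γ(A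
× B × C)` or on `Γ((A × B × C) ⊔ *)`. There each `Γ`-Whitehead product is by construction a
commutator, so the iterated products become iterated commutators (`gpull_smash3Mk_gammaWhitehead`,
`foxWhitehead_foxWhitehead`).

The topology serves to come back from products to smash products. For `q : A → C` that collapses the
fibre `B`, a neighbourhood deformation retract, the homotopy extension property of `ΓB → ΓA` makes
`[ΓC, X] → [ΓA, X] → [ΓB, X]` exact. The relative form `Collapse.exact` also gives injectivity of
the first map without a Puppe sequence: a null-homotopy of a pulled back map is a lift to the path
space of `X`, whose restriction to `ΓB` is a family of loops. If that family extends over `ΓA`, the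
lift can be corrected until it descends to `ΓC`, and the path space is contractible
(`Collapse.gpull_injective`).

For `P × Q → P ∧ Q` the fibre is the wedge. A class on `Γ(P ∨ Q)` is determined by its restrictions
to the two summands, and the product of the pullbacks of these restrictions extends it over `Γ(P ×
Q)`. A commutator of pullbacks dies on both summands. So `Γ`-Whitehead products exist and are
unique. For `W ⊔ * → W` the fibre is an `S⁰` onto which `W ⊔ *` retracts, and the same argument
gives the action of `[Γ, X]`. Well-pointed compactly generated Hausdorff spaces are treated first;
homotopy equivalences carry the results over. Threefold products reduce to twofold ones by absorbing
a factor into `Γ` (`gpull_smashMap_smashMk_injective`).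

In the smash versions the conjugations in Hall-Witt have to be removed or interpreted. If `ΓB` is
co-commutative, classes on `Γ(B × T)` that vanish over the base point of `B` come from `ΓB ∧ (T ⊔
*)`, whose group of classes is abelian; hence conjugation by `β` is trivial
(`HomotopyCocommutative.commute_gpull`). If `B` is `S⁰`, conjugation by `β` is the action of `[Γ,
X]` (`gpull_dotAct`). -/

theorem continuous_prod_of_tests {W : Type u} [TopologicalSpace W] [UCompactlyGeneratedSpace.{u} W]
    {K : Type w} [TopologicalSpace K] [LocallyCompactSpace K] {T : Type v} [TopologicalSpace T]
    {f : W × K → T}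
    (h : ∀ (S : Type u) [TopologicalSpace S] [CompactSpace S] [T2Space S] (g : S → W),
      Continuous g → Continuous fun p : S × K => f (g p.1, p.2)) : Continuous f := by
  -- Currying leaves a map on `W` alone, for which compact Hausdorff tests suffice; local
  -- compactness of `K` allows uncurrying.
  let F : W → C(K, T) := fun x => ⟨fun t => f (x, t),
    (h PUnit (fun _ => x) continuous_const).comp (g := fun p : PUnit × K => f (x, p.2))
      (f := fun t => (PUnit.unit, t)) (continuous_const.prodMk continuous_id)⟩
  have hF : Continuous F := continuous_from_uCompactlyGeneratedSpace.{u} F fun S g =>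
    ContinuousMap.continuous_of_continuous_uncurry _ (h S g g.continuous)
  exact ContinuousMap.continuous_uncurry_of_continuous ⟨F, hF⟩

theorem KProd.continuous_prod_dom {X Y : Type u} [TopologicalSpace X] [TopologicalSpace Y]
    {K : Type w} [TopologicalSpace K] [LocallyCompactSpace K] {T : Type v} [TopologicalSpace T]
    {f : KProd X Y × K → T}
    (h : ∀ (S : Type u) [TopologicalSpace S] [CompactSpace S] [T2Space S] (a : S → X) (b : S → Y),
      Continuous a → Continuous b →
        Continuous fun p : S × K => f (KProd.mk (a p.1) (b p.1), p.2)) : Continuous f :=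
  continuous_prod_of_tests fun S _ _ _ g hg =>
    h S (fun s => (g s).1) (fun s => (g s).2) (KProd.continuous_fst.comp hg)
      (KProd.continuous_snd.comp hg)

theorem isQuotientMap_smashMk (A B : PTop.{u}) : IsQuotientMap (smashMk A B) :=
  isQuotientMap_quotient_mk'

theorem smash_continuous_prod_dom {A B : PTop.{u}}
    {K : Type w} [TopologicalSpace K] [LocallyCompactSpace K] {T : Type v} [TopologicalSpace T]
    {f : smash A B × K → T}
    (h : ∀ (S : Type u) [TopologicalSpace S] [CompactSpace S] [T2Space S] (a : S → A) (b : S → B),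
      Continuous a → Continuous b →
        Continuous fun p : S × K => f (smashMk A B (KProd.mk (a p.1) (b p.1)), p.2)) :
    Continuous f :=
  (isQuotientMap_smashMk A B).continuous_lift_prod_left (KProd.continuous_prod_dom h)

theorem smashMk_eq_iff {A B : PTop.{u}} {p q : prod A B} :
    smashMk A B p = smashMk A B q ↔
      p = q ∨ ((p.1 = A.pt ∨ p.2 = B.pt) ∧ (q.1 = A.pt ∨ q.2 = B.pt)) :=
  ⟨fun h => Quotient.exact (s := smashSetoid A B) h, fun h => Quotient.sound (s := smashSetoid A B) h⟩

theorem smashMk_eq_pt_iff {A B : PTop.{u}} {p : prod A B} :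
    smashMk A B p = (smash A B).pt ↔ p.1 = A.pt ∨ p.2 = B.pt := by
  refine ⟨fun h => ?_, smashMk_eq_pt⟩
  rcases smashMk_eq_iff.1 (h : smashMk A B p = smashMk A B (KProd.mk A.pt B.pt)) with rfl | h
  · exact Or.inl rfl
  · exact h.1

/-- Continuity of a function on `D × C` may be tested after a quotient map onto `C`. -/
theorem KProd.continuous_of_comp_quotient (D : PTop.{u}) {A C : PTop.{u}}
    [UCompactlyGeneratedSpace.{u} A] {q : PMap A C} (hq : IsQuotientMap q) {T : Type v}
    [TopologicalSpace T] {f : prod D C → T}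
    (hf : Continuous fun p : prod D A => f (prodMap (PMap.id D) q p)) : Continuous f := by
  refine KProd.continuous_dom fun S _ _ _ a c ha hc => ?_
  let F : A → C(S, T) := fun x => ⟨fun s => f (KProd.mk (a s) (q x)),
    hf.comp (KProd.continuous_test ha (continuous_const (y := x)))⟩
  have hF : Continuous F := continuous_from_uCompactlyGeneratedSpace.{u} F fun R g =>
    ContinuousMap.continuous_of_continuous_uncurry _ (hf.comp
      (KProd.continuous_test (S := R × S) (ha.comp _root_.continuous_snd)
        (g.continuous.comp _root_.continuous_fst)))
  -- The chosen preimage is arbitrary, but `F` depends only on the image under `q`, so `G` may be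
  -- tested after `q`.
  let G : C → C(S, T) := fun z => F (hq.surjective z).choose
  have hGF : ∀ x, G (q x) = F x := fun x => ContinuousMap.ext fun s => by
    show f (KProd.mk (a s) (q _)) = f (KProd.mk (a s) (q x))
    rw [(hq.surjective (q x)).choose_spec]
  have hG : Continuous G := hq.continuous_iff.2 (by
    convert hF using 1
    exact funext hGF)
  have key := (ContinuousMap.continuous_uncurry_of_continuous ⟨G, hG⟩).comp
    (hc.prodMk continuous_id)
  convert key using 1
  funext s
  obtain ⟨x, hx⟩ := hq.surjective (c s)
  show f (KProd.mk (a s) (c s)) = G (c s) s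
  rw [← hx, hGF]
  rfl

/-- The product with a fixed space preserves quotient maps of compactly generated spaces. -/
theorem isQuotientMap_prodMap_id (D : PTop.{u}) {A C : PTop.{u}} [UCompactlyGeneratedSpace.{u} A]
    {q : PMap A C} (hq : IsQuotientMap q) : IsQuotientMap (prodMap (PMap.id D) q) := by
  refine ⟨isCoinducing_iff.2 fun U => ?_, fun p => ?_⟩
  · exact ⟨fun h => isOpen_iff_continuous_mem.2
      (KProd.continuous_of_comp_quotient D hq (isOpen_iff_continuous_mem.1 h)),
      fun h => h.preimage (prodMap (PMap.id D) q).cont⟩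
  · obtain ⟨a, ha⟩ := hq.surjective p.2
    exact ⟨KProd.mk p.1 a, Prod.ext rfl ha⟩

/-- Thanks to this, a map on `ΓA` that is constant on the fibres of `ΓA → ΓC` descends continuously
to `ΓC`. -/
theorem isQuotientMap_smashMap_id (D : PTop.{u}) {A C : PTop.{u}} [UCompactlyGeneratedSpace.{u} A]
    {q : PMap A C} (hq : IsQuotientMap q) : IsQuotientMap (smashMap (PMap.id D) q) :=
  IsQuotientMap.of_comp (smashMk D A).cont (smashMap (PMap.id D) q).cont
    ((isQuotientMap_smashMk D C).comp (isQuotientMap_prodMap_id D hq))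

/-! ### Functoriality -/

section Functoriality

variable {A B C D : PTop.{u}} {X Y : PTop.{v}}

theorem smash_ext {f g : PMap (smash A B) X}
    (h : ∀ (a : A) (b : B), f (smashMk A B (KProd.mk a b)) = g (smashMk A B (KProd.mk a b))) :
    f = g :=
  PMap.ext_fun (by rintro ⟨p⟩; exact h p.1 p.2)

theorem HClass.pull_comp (f : PMap A B) (g : PMap B C) (κ : HClass C X) :
    HClass.pull f (HClass.pull g κ) = HClass.pull (g.comp f) κ := by
  induction κ using Quotient.inductionOn; rfl

theorem HClass.pull_congr {f g : PMap A B} (h : f.Homotopic g) (κ : HClass B X) :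
    HClass.pull f κ = HClass.pull g κ := by
  induction κ using Quotient.inductionOn with
  | h k => exact Quotient.sound ((PMap.Homotopic.refl k).comp h)

theorem HClass.pull_id (κ : HClass A X) : HClass.pull (PMap.id A) κ = κ := by
  induction κ using Quotient.inductionOn; rfl

theorem comp_mulMap [CoGroup A] (e : PMap X Y) (f g : PMap A X) :
    e.comp (mulMap f g) = mulMap (e.comp f) (e.comp g) := by
  refine PMap.ext_fun fun z => ?_
  show e (copair f g (CoGroup.comul z)) = copair (e.comp f) (e.comp g) (CoGroup.comul z)
  generalize (CoGroup.comul z : wedge A A) = p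
  rcases p.2 with hp | hp
  · rw [copair_right _ _ hp, copair_right _ _ hp]; rfl
  · rw [copair_left _ _ hp, copair_left _ _ hp]; rfl

/-- A map that commutes with the co-multiplications. -/
def IsCoHom [CoGroup A] [CoGroup B] (φ : PMap A B) : Prop :=
  (CoGroup.comul (Z := B)).comp φ = (wedgeMap φ φ).comp CoGroup.comul

theorem IsCoHom.mulMap_comp [CoGroup A] [CoGroup B] {φ : PMap A B} (h : IsCoHom φ)
    (f g : PMap B X) : (mulMap f g).comp φ = mulMap (f.comp φ) (g.comp φ) := by
  refine PMap.ext_fun fun z => ?_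
  show copair f g (CoGroup.comul (φ z)) = copair (f.comp φ) (g.comp φ) (CoGroup.comul z)
  have e : (CoGroup.comul (φ z) : wedge B B) = wedgeMap φ φ (CoGroup.comul z) :=
    congrArg (fun k : PMap A (wedge B B) => k z) h
  rw [e]
  generalize (CoGroup.comul z : wedge A A) = p
  rcases p.2 with hp | hp
  · rw [copair_right _ _ hp, copair_right]
    · rfl
    · show φ p.1.1 = _
      rw [hp, φ.map_pt]
  · rw [copair_left _ _ hp, copair_left]
    · rfl
    · show φ p.1.2 = _
      rw [hp, φ.map_pt]

theorem IsCoHom.pull_mul [CoGroup A] [CoGroup B] {φ : PMap A B} (h : IsCoHom φ)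
    (κ ν : HClass B X) : HClass.pull φ (κ * ν) = HClass.pull φ κ * HClass.pull φ ν := by
  induction κ using Quotient.inductionOn with
  | h f =>
    induction ν using Quotient.inductionOn with
    | h g => exact congrArg (Quotient.mk _) (h.mulMap_comp f g)

variable {Γ : PTop.{u}}

/-- The co-multiplication touches only the factor `Γ`, so the compatibility is strict and not merely
up to homotopy. -/
theorem isCoHom_smashMap [CoGroup Γ] (f : PMap A B) : IsCoHom (smashMap (PMap.id Γ) f) :=
  smash_ext fun _ _ => rfl

/-- Pulling back along `Γf` is a group homomorphism. -/
noncomputable def gpullHom (Γ : PTop.{u}) [CoGroup Γ] (f : PMap A B) :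
    HClass (smash Γ B) X →* HClass (smash Γ A) X :=
  MonoidHom.mk' (gpull Γ f) fun κ ν => (isCoHom_smashMap f).pull_mul κ ν

theorem gpull_mul [CoGroup Γ] (f : PMap A B) (κ ν : HClass (smash Γ B) X) :
    gpull Γ f (κ * ν) = gpull Γ f κ * gpull Γ f ν := map_mul (gpullHom Γ f) κ ν

theorem gpull_one [CoGroup Γ] (f : PMap A B) :
    gpull Γ f (1 : HClass (smash Γ B) X) = 1 := map_one (gpullHom Γ f)

theorem gpull_inv [CoGroup Γ] (f : PMap A B) (κ : HClass (smash Γ B) X) :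
    gpull Γ f κ⁻¹ = (gpull Γ f κ)⁻¹ := map_inv (gpullHom Γ f) κ

theorem gpull_commutator [CoGroup Γ] (f : PMap A B) (κ ν : HClass (smash Γ B) X) :
    gpull Γ f ⁅κ, ν⁆ = ⁅gpull Γ f κ, gpull Γ f ν⁆ := map_commutatorElement (gpullHom Γ f) κ ν

theorem gpull_gpull (f : PMap A B) (g : PMap B C) (κ : HClass (smash Γ C) X) :
    gpull Γ f (gpull Γ g κ) = gpull Γ (g.comp f) κ := by
  unfold gpull
  rw [HClass.pull_comp]
  exact congrArg (fun k => HClass.pull k κ) (smash_ext fun _ _ => rfl)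

theorem gpull_id (κ : HClass (smash Γ A) X) : gpull Γ (PMap.id A) κ = κ := by
  unfold gpull
  rw [show smashMap (PMap.id Γ) (PMap.id A) = PMap.id _ from smash_ext fun _ _ => rfl,
    HClass.pull_id]

theorem gpull_const [CoGroup Γ] (κ : HClass (smash Γ B) X) :
    gpull Γ (PMap.const A B) κ = 1 := by
  induction κ using Quotient.inductionOn with
  | h k =>
    refine congrArg (Quotient.mk _) (smash_ext fun a b => ?_)
    exact (congrArg k (smashMk_eq_pt (p := KProd.mk a B.pt) (Or.inr rfl))).trans k.map_pt

/-- The interchange of factors. -/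
def smashSwap (A B : PTop.{u}) : PMap (smash A B) (smash B A) :=
  smashLift ((smashMk B A).comp (prodLift (prodSnd A B) (prodFst A B))) fun _ h =>
    smashMk_eq_pt h.symm

theorem smashMap_homotopic_right (f : PMap A B) {g g' : PMap C D} (hg : g.Homotopic g') :
    (smashMap f g).Homotopic (smashMap f g') := by
  have key := ((PMap.Homotopic.refl (smashSwap D B)).comp (smashMap_homotopic hg f)).comp
    (PMap.Homotopic.refl (smashSwap A C))
  convert key using 1 <;> exact smash_ext fun _ _ => rfl

theorem gpull_congr {f g : PMap A B} (h : f.Homotopic g) (κ : HClass (smash Γ B) X) :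
    gpull Γ f κ = gpull Γ g κ :=
  HClass.pull_congr (smashMap_homotopic_right _ h) κ

theorem gpull_gpull_of_homotopic_id {f : PMap A B} {g : PMap B A}
    (h : (g.comp f).Homotopic (PMap.id A)) (κ : HClass (smash Γ A) X) :
    gpull Γ f (gpull Γ g κ) = κ := by
  rw [gpull_gpull, gpull_congr h, gpull_id]

/-- The class of a map. -/
def PMap.cls (f : PMap A X) : HClass A X := Quotient.mk _ f

theorem PMap.cls_eq_iff {f g : PMap A X} : f.cls = g.cls ↔ f.Homotopic g :=
  ⟨fun h => Quotient.exact h, fun h => Quotient.sound h⟩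

theorem PMap.cls_eq_one_iff [CoGroup A] {f : PMap A X} :
    f.cls = 1 ↔ f.Homotopic (PMap.const A X) := PMap.cls_eq_iff

end Functoriality

/-! ### Cofibrations and exactness -/

/-- Strøm's characterization of cofibrations: `B` is a neighbourhood deformation retract of `A`,
with a function `w` such that the deformation has moved the point `p` into `B` from time `w p`
on. -/
structure NDR {A : Type u} [TopologicalSpace A] (B : Set A) where
  /-- the time at which a point has arrived in `B` -/
  w : A → ℝ
  /-- the deformation -/
  h : A × I → A
  continuous_w : Continuous w
  continuous_h : Continuous h
  w_nonneg : ∀ p, 0 ≤ w p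
  w_eq_zero : ∀ p ∈ B, w p = 0
  h_zero : ∀ p, h (p, 0) = p
  h_mem : ∀ p ∈ B, ∀ t, h (p, t) = p
  h_arrived : ∀ p (t : I), w p ≤ t → h (p, t) ∈ B

section Exact

variable {A C : PTop.{u}} {X Y Y₂ : PTop.{v}} {Γ : PTop.{u}}

/-- The fibre of a pointed map, as a subspace. -/
def fiber (q : PMap A C) : PTop.{u} := ⟨{p : A // q p = C.pt}, ⟨A.pt, q.map_pt⟩⟩

/-- The inclusion of the fibre. -/
def fiberIncl (q : PMap A C) : PMap (fiber q) A := ⟨⟨Subtype.val, continuous_subtype_val⟩, rfl⟩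

/-- The map of `ΓB` to `ΓA`, for the fibre `B` of `A → C`. -/
def smashFiberIncl (Γ : PTop.{u}) (q : PMap A C) : PMap (smash Γ (fiber q)) (smash Γ A) :=
  smashMap (PMap.id Γ) (fiberIncl q)

open Classical in
/-- The homotopy extension property of `ΓB → ΓA`. -/
theorem homotopy_extension {q : PMap A C} (N : NDR {p : A | q p = C.pt})
    (f : PMap (smash Γ A) Y) (G : smash Γ (fiber q) × I → Y) (hG : Continuous G)
    (hG0 : ∀ x, G (x, 0) = f (smashFiberIncl Γ q x))
    (hGp : ∀ t, G ((smash Γ (fiber q)).pt, t) = Y.pt) :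
    ∃ F : smash Γ A × I → Y, Continuous F ∧ (∀ x, F (x, 0) = f x) ∧
      (∀ x t, F (smashFiberIncl Γ q x, t) = G (x, t)) ∧ ∀ t, F ((smash Γ A).pt, t) = Y.pt := by
  have hr : ∀ p : A, ∀ t : I, N.w p ≤ t → q (N.h (p, Set.projIcc 0 1 zero_le_one (N.w p))) = C.pt :=
    fun p t ht => N.h_arrived p _ (by
      rw [Set.projIcc_of_mem _ ⟨N.w_nonneg p, ht.trans t.2.2⟩])
  let r : ∀ p : A, ∀ t : I, N.w p ≤ t → fiber q := fun p t ht => ⟨_, hr p t ht⟩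
  -- Until its time of arrival `w`, a point is carried along the deformation and mapped by `f`;
  -- afterwards it stays where it arrived in `B` and `G` runs from time `0`.
  let F₀ : prod Γ A × I → Y := fun p =>
    if ht : N.w p.1.2 ≤ p.2 then
      G (smashMk Γ (fiber q) (KProd.mk p.1.1 (r p.1.2 p.2 ht)),
        Set.projIcc 0 1 zero_le_one (p.2 - N.w p.1.2))
    else f (smashMk Γ A (KProd.mk p.1.1 (N.h (p.1.2, p.2))))
  have F₀_pt : ∀ p : prod Γ A, p.1 = Γ.pt ∨ p.2 = A.pt → ∀ t, F₀ (p, t) = Y.pt := by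
    intro p hp t
    by_cases ht : N.w p.2 ≤ t
    · simp only [F₀, dif_pos ht]
      rw [show smashMk Γ (fiber q) (KProd.mk p.1 (r p.2 t ht)) = (smash Γ (fiber q)).pt from
        smashMk_eq_pt (hp.imp id fun h => Subtype.ext ?_), hGp]
      show N.h (p.2, _) = A.pt
      rw [h]
      exact N.h_mem _ q.map_pt _
    · simp only [F₀, dif_neg ht]
      rw [show smashMk Γ A (KProd.mk p.1 (N.h (p.2, t))) = (smash Γ A).pt from
        smashMk_eq_pt (hp.imp id fun h => ?_), f.map_pt]
      show N.h (p.2, _) = A.pt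
      rw [h]
      exact N.h_mem _ q.map_pt _
  -- Because `G` starts at `f`, the formula before arrival still holds at the instant of arrival. So
  -- `F₀` is continuous on two closed sets that cover the cylinder.
  have F₀_late : ∀ p : prod Γ A, ∀ t : I, (t : ℝ) ≤ N.w p.2 →
      F₀ (p, t) = f (smashMk Γ A (KProd.mk p.1 (N.h (p.2, t)))) := by
    intro p t ht
    by_cases ht' : N.w p.2 ≤ t
    · have e : N.w p.2 = t := le_antisymm ht' ht
      simp only [F₀, dif_pos ht', e, sub_self, Set.projIcc_left]
      erw [hG0]
      show f (smashMk Γ A (KProd.mk p.1 (N.h (p.2, _)))) = _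
      rw [e, Set.projIcc_val]
    · simp only [F₀, dif_neg ht']
  let F : smash Γ A × I → Y := fun x => Quotient.lift (s := smashSetoid Γ A)
    (fun p => F₀ (p, x.2)) (by
      rintro p p' (rfl | ⟨h, h'⟩)
      · rfl
      · show F₀ (p, x.2) = F₀ (p', x.2)
        rw [F₀_pt p h, F₀_pt p' h']) x.1
  refine ⟨F, ?_, ?_, ?_, fun t => F₀_pt _ (Or.inl rfl) t⟩
  · refine smash_continuous_prod_dom fun S _ _ _ a b ha hb => ?_
    show Continuous fun p : S × I => F₀ (KProd.mk (a p.1) (b p.1), p.2)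
    have hw : Continuous fun p : S × I => N.w (b p.1) :=
      N.continuous_w.comp (hb.comp continuous_fst)
    have ht : Continuous fun p : S × I => (p.2 : ℝ) := by fun_prop
    have c1 : IsClosed {p : S × I | N.w (b p.1) ≤ p.2} := isClosed_le hw ht
    have c2 : IsClosed {p : S × I | (p.2 : ℝ) ≤ N.w (b p.1)} := isClosed_le ht hw
    rw [← continuousOn_univ, show (Set.univ : Set (S × I)) =
      {p : S × I | N.w (b p.1) ≤ p.2} ∪ {p : S × I | (p.2 : ℝ) ≤ N.w (b p.1)} from
        (Set.eq_univ_of_forall fun p : S × I => le_total (N.w (b p.1)) p.2).symm]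
    refine ContinuousOn.union_of_isClosed ?_ ?_ c1 c2
    · rw [continuousOn_iff_continuous_domRestrict]
      let R := {p : S × I // N.w (b p.1) ≤ p.2}
      -- The topology of `Γ × B` is tested by compact Hausdorff spaces; a closed part of `S × I` is
      -- again one.
      have : CompactSpace R := isCompact_iff_compactSpace.1 c1.isCompact
      have e : Set.domRestrict {p : S × I | N.w (b p.1) ≤ p.2}
          (fun p : S × I => F₀ (KProd.mk (a p.1) (b p.1), p.2)) = fun s : R =>
          G (smashMk Γ (fiber q) (KProd.mk (a s.1.1) (r (b s.1.1) s.1.2 s.2)),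
            Set.projIcc 0 1 zero_le_one (s.1.2 - N.w (b s.1.1))) :=
        funext fun s => dif_pos s.2
      rw [e]
      refine hG.comp (Continuous.prodMk ?_ ?_)
      · refine (smashMk Γ (fiber q)).cont.comp (KProd.continuous_test (S := R) ?_ ?_)
        · exact ha.comp (continuous_fst.comp continuous_subtype_val)
        · refine Continuous.subtype_mk (N.continuous_h.comp (Continuous.prodMk ?_ ?_)) _
          · exact hb.comp (continuous_fst.comp continuous_subtype_val)
          · exact continuous_projIcc.comp (hw.comp continuous_subtype_val)
      · exact continuous_projIcc.comp ((ht.sub hw).comp continuous_subtype_val)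
    · have k : Continuous fun p : S × I =>
          f (smashMk Γ A (KProd.mk (a p.1) (N.h (b p.1, p.2)))) := by
        refine f.cont.comp ((smashMk Γ A).cont.comp (KProd.continuous_test (S := S × I) ?_ ?_))
        · exact ha.comp continuous_fst
        · exact N.continuous_h.comp ((hb.comp continuous_fst).prodMk continuous_snd)
      exact k.continuousOn.congr fun p hp => F₀_late _ _ hp
  · rintro ⟨p⟩
    show F₀ (p, 0) = f (smashMk Γ A p)
    rw [F₀_late p 0 (N.w_nonneg _), N.h_zero]
    rfl
  · rintro ⟨p⟩ t
    show F₀ (KProd.mk p.1 p.2.1, t) = G (smashMk Γ (fiber q) p, t)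
    have e : N.w p.2.1 = 0 := N.w_eq_zero _ p.2.2
    have ht : N.w p.2.1 ≤ t := e.le.trans t.2.1
    have e' : r p.2.1 t ht = p.2 := Subtype.ext (N.h_mem _ p.2.2 _)
    refine (dif_pos ht).trans ?_
    show G (smashMk Γ (fiber q) (KProd.mk p.1 (r p.2.1 t ht)),
        Set.projIcc 0 1 zero_le_one (t - N.w p.2.1)) = _
    rw [e', e, sub_zero, Set.projIcc_val]
    rfl

/-- The map `q` collapses its fibre over the base point, and nothing else. -/
structure Collapse (q : PMap A C) : Prop where
  isQuotientMap : IsQuotientMap q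
  eq_or : ∀ p p', q p = q p' → p = p' ∨ q p = C.pt

/-- Two points with the same image in `ΓC` are either equal or both come from `ΓB`, where `f` takes
the single value `y`. -/
theorem Collapse.factors {q : PMap A C} (hq : Collapse q) {T : Type v} {f : smash Γ A → T} {y : T}
    (hf : ∀ x, f (smashFiberIncl Γ q x) = y) {x x' : smash Γ A}
    (h : smashMap (PMap.id Γ) q x = smashMap (PMap.id Γ) q x') : f x = f x' := by
  have key : ∀ p : prod Γ A, p.1 = Γ.pt ∨ q p.2 = C.pt → f (smashMk Γ A p) = y := by
    rintro p (hp | hp)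
    · rw [smashMk_eq_pt (Or.inl hp), ← hf (smash Γ (fiber q)).pt, PMap.map_pt]
    · exact hf (smashMk Γ (fiber q) (KProd.mk p.1 ⟨p.2, hp⟩))
  obtain ⟨p, rfl⟩ := (isQuotientMap_smashMk Γ A).surjective x
  obtain ⟨p', rfl⟩ := (isQuotientMap_smashMk Γ A).surjective x'
  rcases smashMk_eq_iff.1 (h : smashMk Γ C (KProd.mk p.1 (q p.2)) =
    smashMk Γ C (KProd.mk p'.1 (q p'.2))) with h | ⟨h, h'⟩
  · obtain ⟨h₁, h₂⟩ := Prod.mk.inj h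
    rcases hq.eq_or _ _ h₂ with h' | h'
    · rw [show p = p' from Prod.ext h₁ h']
    · rw [key p (Or.inr h'), key p' (Or.inr (h₂.symm.trans h'))]
  · rw [key p h, key p' h']

/-- A map on `ΓA` whose restriction to `ΓB` is null-homotopic is induced, up to homotopy, by a map
on `ΓC`. If the null-homotopy lies over a constant homotopy, then so does the given homotopy. -/
theorem Collapse.exact [UCompactlyGeneratedSpace.{u} A] {q : PMap A C} (hq : Collapse q)
    (N : NDR {p : A | q p = C.pt}) (f : PMap (smash Γ A) Y) (e : PMap Y Y₂)
    (f₂ : PMap (smash Γ C) Y₂) (hf : e.comp f = f₂.comp (smashMap (PMap.id Γ) q))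
    (G : I × smash Γ (fiber q) → Y) (hG : Continuous G)
    (hG0 : ∀ x, G (0, x) = f (smashFiberIncl Γ q x)) (hG1 : ∀ x, G (1, x) = Y.pt)
    (hGp : ∀ t, G (t, (smash Γ (fiber q)).pt) = Y.pt) (hGe : ∀ t x, e (G (t, x)) = Y₂.pt) :
    ∃ f' : PMap (smash Γ C) Y, f.Homotopic (f'.comp (smashMap (PMap.id Γ) q)) ∧
      f₂.Homotopic (e.comp f') := by
  have Q := isQuotientMap_smashMap_id Γ hq.isQuotientMap
  obtain ⟨F, hF, hF0, hFG, hFp⟩ := homotopy_extension N f (fun x => G (x.2, x.1))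
    (hG.comp continuous_swap) hG0 hGp
  -- At time `1` the extended homotopy is constant on `ΓB`, so its end descends to `ΓC`.
  have hl : Function.FactorsThrough (fun x => F (x, 1)) (smashMap (PMap.id Γ) q) :=
    fun x x' h => hq.factors (f := fun x => F (x, 1)) (y := Y.pt)
      (fun x => (hFG x 1).trans (hG1 x)) h
  let F₁ : C(smash Γ A, Y) :=
    ⟨fun x => F (x, 1), hF.comp (continuous_id.prodMk continuous_const)⟩
  have hl' : ∀ x, Q.lift (f := (smashMap (PMap.id Γ) q).toMap) F₁ hl
      (smashMap (PMap.id Γ) q x) = F (x, 1) := fun x =>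
    congrArg (fun k : C(smash Γ A, Y) => k x) (Q.lift_comp F₁ hl)
  let f' : PMap (smash Γ C) Y := ⟨Q.lift (f := (smashMap (PMap.id Γ) q).toMap) F₁ hl, by
    rw [← (smashMap (PMap.id Γ) q).map_pt, hl', hFp]⟩
  have hf' : ∀ x, f' (smashMap (PMap.id Γ) q x) = F (x, 1) := hl'
  refine ⟨f', PMap.homotopic_iff.2 ⟨fun x => F (x.2, x.1), hF.comp continuous_swap, hF0,
    fun x => (hf' x).symm, hFp⟩, ?_⟩
  have hs := Q.surjective
  -- After composition with `e` the extension is constant on `ΓB` at every time, so the entire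
  -- homotopy descends.
  let H : I × smash Γ C → Y₂ := fun z => e (F ((hs z.2).choose, z.1))
  have hH : ∀ t x, H (t, smashMap (PMap.id Γ) q x) = e (F (x, t)) := fun t x =>
    hq.factors (f := fun x => e (F (x, t))) (y := Y₂.pt)
      (fun x => by rw [hFG x t]; exact hGe t x) (hs _).choose_spec
  refine PMap.homotopic_iff.2 ⟨H, ?_, fun z => ?_, fun z => ?_, fun t => ?_⟩
  · refine Q.continuous_lift_prod_right ?_
    simp only [hH]
    exact e.cont.comp (hF.comp continuous_swap)
  · obtain ⟨x, rfl⟩ := hs z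
    rw [hH, hF0]
    exact congrArg (fun k : PMap (smash Γ A) Y₂ => k x) hf
  · obtain ⟨x, rfl⟩ := hs z
    rw [hH]
    show _ = e (f' _)
    rw [hf']
  · rw [← (smashMap (PMap.id Γ) q).map_pt, hH, hFp, e.map_pt]

/-- `Collapse.exact` with a constant `e`, so that the condition over `Y₂` is void. -/
theorem Collapse.exists_gpull_eq [CoGroup Γ] [UCompactlyGeneratedSpace.{u} A] {q : PMap A C}
    (hq : Collapse q) (N : NDR {p : A | q p = C.pt}) (κ : HClass (smash Γ A) X)
    (h : gpull Γ (fiberIncl q) κ = 1) : ∃ κ', gpull Γ q κ' = κ := by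
  induction κ using Quotient.inductionOn with
  | h f =>
    obtain ⟨G, hG, hG0, hG1, hGp⟩ := PMap.homotopic_iff.1 (PMap.cls_eq_one_iff.1
      (h : (f.comp (smashFiberIncl Γ q)).cls = 1))
    obtain ⟨f', hf', -⟩ := hq.exact N f (PMap.const X X) (PMap.const _ X) rfl G hG hG0 hG1 hGp
      fun _ _ => rfl
    exact ⟨f'.cls, (PMap.cls_eq_iff.2 hf').symm⟩

/-- The space of paths that end at the base point. -/
def pathSpace (X : PTop.{v}) : PTop.{v} :=
  ⟨{p : C(I, X) // p 1 = X.pt}, ⟨ContinuousMap.const I X.pt, rfl⟩⟩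

/-- The loop space. -/
def loopSpace (X : PTop.{v}) : PTop.{v} :=
  ⟨{p : C(I, X) // p 0 = X.pt ∧ p 1 = X.pt}, ⟨ContinuousMap.const I X.pt, rfl, rfl⟩⟩

/-- The inclusion of the loop space into the path space. -/
def loopIncl (X : PTop.{v}) : PMap (loopSpace X) (pathSpace X) :=
  ⟨⟨fun p => ⟨p.1, p.2.2⟩, by fun_prop⟩, rfl⟩

/-- The evaluation of a path at its start. -/
def pathEval (X : PTop.{v}) : PMap (pathSpace X) X :=
  ⟨⟨fun p => p.1 0, (continuous_eval_const 0).comp continuous_subtype_val⟩, rfl⟩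

/-- Move the point of evaluation from the start of each path to its end. -/
theorem pathEval_homotopic_const (X : PTop.{v}) :
    (pathEval X).Homotopic (PMap.const _ X) :=
  PMap.homotopic_iff.2 ⟨fun p => p.2.1 p.1, by
    have : Continuous fun p : I × pathSpace X => (p.2.1 : C(I, X)) :=
      continuous_subtype_val.comp continuous_snd
    exact this.eval continuous_fst, fun _ => rfl, fun p => p.2, fun _ => rfl⟩

/-- If every class on `ΓB` with values in the loop space extends to `ΓA`, then
`[ΓC, X] → [ΓA, X]` is injective. -/
theorem Collapse.gpull_injective [CoGroup Γ] [UCompactlyGeneratedSpace.{u} A] {q : PMap A C}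
    (hq : Collapse q) (N : NDR {p : A | q p = C.pt})
    (hs : Function.Surjective
      (gpull Γ (fiberIncl q) : HClass (smash Γ A) (loopSpace X) → _)) :
    Function.Injective (gpull Γ q : HClass (smash Γ C) X → _) := by
  refine (injective_iff_map_eq_one (gpullHom Γ q)).2 fun κ hκ => ?_
  induction κ using Quotient.inductionOn with
  | h f =>
    obtain ⟨H, hH, hH0, hH1, hHp⟩ := PMap.homotopic_iff.1 (PMap.cls_eq_one_iff.1
      (hκ : (f.comp (smashMap (PMap.id Γ) q)).cls = 1))
    -- The null-homotopy, read as a lift of `f ∘ Γq` to the path space. On `ΓB` the paths also start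
    -- at the base point, which yields `l` below.
    let n : PMap (smash Γ A) (pathSpace X) := ⟨⟨fun x => ⟨⟨fun t => H (t, x), by fun_prop⟩, hH1 x⟩,
      Continuous.subtype_mk (ContinuousMap.curry
        ⟨fun p : smash Γ A × I => H (p.2, p.1), hH.comp continuous_swap⟩).continuous _⟩, Subtype.ext (ContinuousMap.ext hHp)⟩
    have hH0' : ∀ x, H (0, smashFiberIncl Γ q x) = X.pt := fun x => by
      rw [hH0]
      obtain ⟨p, rfl⟩ := (isQuotientMap_smashMk Γ (fiber q)).surjective x
      exact (congrArg f (smashMk_eq_pt (p := KProd.mk p.1 (q p.2.1)) (Or.inr p.2.2))).trans f.map_pt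
    let l : PMap (smash Γ (fiber q)) (loopSpace X) :=
      ⟨⟨fun x => ⟨⟨fun t => H (t, smashFiberIncl Γ q x), by fun_prop⟩, hH0' x, hH1 _⟩,
        Continuous.subtype_mk (ContinuousMap.curry
          ⟨fun p : smash Γ (fiber q) × I => H (p.2, smashFiberIncl Γ q p.1), hH.comp
            (continuous_snd.prodMk ((smashFiberIncl Γ q).cont.comp continuous_fst))⟩).continuous _⟩,
        Subtype.ext (ContinuousMap.ext fun t => by
          show H (t, smashFiberIncl Γ q (smash Γ (fiber q)).pt) = X.pt
          rw [PMap.map_pt, hHp])⟩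
    -- Multiplying `n` by an extension of the inverse of `l` makes the lift null-homotopic on `ΓB`
    -- through loops. Its start changes only by a trivial factor.
    obtain ⟨m, hm⟩ := hs (l.cls⁻¹)
    induction m using Quotient.inductionOn with
    | h m =>
      let n' : PMap (smash Γ A) (pathSpace X) := mulMap n ((loopIncl X).comp m)
      have e1 : n'.comp (smashFiberIncl Γ q) =
          (loopIncl X).comp (mulMap l (m.comp (smashFiberIncl Γ q))) := by
        rw [comp_mulMap]
        exact (isCoHom_smashMap (fiberIncl q)).mulMap_comp _ _
      have e2 : (pathEval X).comp n' =
          (mulMap f (PMap.const _ X)).comp (smashMap (PMap.id Γ) q) := by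
        rw [comp_mulMap, (isCoHom_smashMap q).mulMap_comp]
        congr 1
        · exact PMap.ext_fun hH0
        · exact PMap.ext_fun fun x => (m x).2.1
      have e3 : (mulMap l (m.comp (smashFiberIncl Γ q))).Homotopic (PMap.const _ _) := by
        refine PMap.cls_eq_one_iff.1 ?_
        show l.cls * gpull Γ (fiberIncl q) m.cls = 1
        rw [show gpull Γ (fiberIncl q) m.cls = l.cls⁻¹ from hm, mul_inv_cancel]
      obtain ⟨G, hG, hG0, hG1, hGp⟩ := PMap.homotopic_iff.1 e3
      obtain ⟨f', -, hf'⟩ := hq.exact N n' (pathEval X) (mulMap f (PMap.const _ X)) e2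
        (fun x => loopIncl X (G x)) ((loopIncl X).cont.comp hG)
        (fun x => by
          rw [hG0]
          exact (congrArg (fun k : PMap (smash Γ (fiber q)) (pathSpace X) => k x) e1).symm)
        (fun x => by rw [hG1]; rfl) (fun t => by rw [hGp]; rfl) (fun t x => (G (t, x)).2.1)
      -- The corrected lift descends, so `f` is homotopic to a map that factors through the
      -- contractible path space.
      have e4 : f.cls * 1 = ((pathEval X).comp f').cls := PMap.cls_eq_iff.2 hf'
      have e5 : ((pathEval X).comp f').cls = ((PMap.const _ X).comp f').cls :=
        PMap.cls_eq_iff.2 ((pathEval_homotopic_const X).comp (PMap.Homotopic.refl f'))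
      rw [mul_one, e5] at e4
      exact e4

end Exact

/-! ### Neighbourhood deformation retracts -/

section NDR

variable {A C P Q W : PTop.{u}}

/-- The first coordinate of the retraction is the deformation. Where it has not reached the base
point, the second coordinate is `0`, so `t` is at most the supremum of `t - r₂`. Twice this supremum
serves as arrival time, which makes the inequality strict for `t > 0`. -/
theorem WellPointed.nonempty_ndr (h : WellPointed P) : Nonempty (NDR ({P.pt} : Set P)) := by
  obtain ⟨hc, r, hr, hr'⟩ := h
  let d : C(P, C(I, ℝ)) := ContinuousMap.curry
    ⟨fun p : P × I => (p.2 : ℝ) - (r p).2, by fun_prop⟩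
  have hd : ∀ p (t : I), (t : ℝ) - (r (p, t)).2 ≤ ‖d p‖ := fun p t =>
    (le_abs_self _).trans ((d p).norm_coe_le_norm t)
  refine ⟨⟨fun p => 2 * ‖d p‖, fun x => (r x).1, by fun_prop, by fun_prop, fun p => by positivity,
    ?_, fun p => ?_, ?_, fun p t ht => ?_⟩⟩
  · rintro p (rfl : p = P.pt)
    have : d P.pt = 0 := ContinuousMap.ext fun t => by
      show (t : ℝ) - (r (P.pt, t)).2 = 0
      rw [hr' (P.pt, t) (Or.inr rfl), sub_self]
    simp [this]
  · show (r (p, 0)).1 = p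
    rw [hr' (p, 0) (Or.inl rfl)]
  · rintro p (rfl : p = P.pt) t
    show (r (P.pt, t)).1 = P.pt
    rw [hr' (P.pt, t) (Or.inr rfl)]
  · have arrived : ∀ t : I, ‖d p‖ < t → (r (p, t)).1 = P.pt := fun t ht =>
      (hr (p, t)).resolve_left fun h => by
        have := hd p t
        rw [h] at this
        simp only [Set.Icc.coe_zero, sub_zero] at this
        linarith
    -- At `t = 0` doubling gives no strict inequality. There the point has arrived at all positive
    -- times, hence also in the limit, as the base point is closed.
    rcases (t.2.1 : (0 : ℝ) ≤ t).eq_or_lt with h0 | h0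
    · have hn : ‖d p‖ = 0 := le_antisymm (by linarith) (norm_nonneg _)
      have ht0 : t = 0 := Subtype.ext h0.symm
      have hcl : IsClosed {s : I | (r (p, s)).1 = P.pt} :=
        hc.preimage (f := fun s : I => (r (p, s)).1) (by fun_prop)
      have hden : Dense (Set.Ioi (0 : I)) := by
        rw [dense_iff_closure_eq, closure_Ioi' ⟨1, zero_lt_one⟩]
        exact Set.eq_univ_of_forall fun s => s.2.1
      have : (t : I) ∈ {s : I | (r (p, s)).1 = P.pt} := by
        refine closure_minimal (fun s hs => arrived s ?_) hcl (hden t)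
        rw [hn]
        exact hs
      exact this
    · exact arrived t (by linarith)

theorem NDR.eq_pt_of_w_eq_zero (N : NDR ({P.pt} : Set P)) {p : P} (h : N.w p = 0) : p = P.pt := by
  rw [← N.h_zero p]
  exact N.h_arrived p 0 h.le

/-- The retraction moves `(p, t)` along the deformation until it arrives, and spends the remaining
time `t - w p` in the second coordinate. -/
theorem NDR.wellPointed (N : NDR ({P.pt} : Set P)) : WellPointed P := by
  refine ⟨?_, ⟨fun x => (N.h (x.1, min x.2 (Set.projIcc 0 1 zero_le_one (N.w x.1))),
    Set.projIcc 0 1 zero_le_one ((x.2 : ℝ) - N.w x.1)), ?_⟩, fun x => ?_, fun x hx => ?_⟩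
  · have : ({P.pt} : Set P) = N.w ⁻¹' {0} := Set.ext fun p =>
      ⟨fun h => N.w_eq_zero p h, fun h => N.eq_pt_of_w_eq_zero h⟩
    rw [this]
    exact isClosed_singleton.preimage N.continuous_w
  · have hw : Continuous fun x : P × I => N.w x.1 := N.continuous_w.comp continuous_fst
    exact (N.continuous_h.comp (continuous_fst.prodMk
      (continuous_snd.min (continuous_projIcc.comp hw)))).prodMk
        (continuous_projIcc.comp (Continuous.sub (by fun_prop) hw))
  · rcases le_total (x.2 : ℝ) (N.w x.1) with h | h
    · exact Or.inl (Set.projIcc_of_le_left zero_le_one (sub_nonpos.2 h))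
    · refine Or.inr (N.h_arrived _ _ ?_)
      have hm : N.w x.1 ∈ Set.Icc (0 : ℝ) 1 := ⟨N.w_nonneg _, h.trans x.2.2.2⟩
      rw [Set.projIcc_of_mem _ hm]
      exact le_min h le_rfl
  · obtain ⟨p, t⟩ := x
    rcases hx with (rfl : t = 0) | (rfl : p = P.pt)
    · refine Prod.ext ?_ (Set.projIcc_of_le_left zero_le_one (by simpa using N.w_nonneg p))
      exact (congrArg (fun t => N.h (p, t)) (min_eq_left (Subtype.prop (Set.projIcc (0 : ℝ) 1
        zero_le_one (N.w p))).1)).trans (N.h_zero p)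
    · refine Prod.ext (N.h_mem _ rfl _) ?_
      show Set.projIcc (0 : ℝ) 1 zero_le_one ((t : ℝ) - N.w P.pt) = t
      rw [N.w_eq_zero _ rfl, sub_zero, Set.projIcc_val]

/-- The quotient of a neighbourhood deformation retract. -/
theorem NDR.collapse {q : PMap A C} (N : NDR {p : A | q p = C.pt}) (hq : Collapse q) :
    Nonempty (NDR ({C.pt} : Set C)) := by
  have hs := hq.isQuotientMap.surjective
  -- This section need not be continuous. The functions built from it do not depend on its choice,
  -- so they are continuous by the quotient property.
  let s : C → A := fun z => (hs z).choose
  have hqs : ∀ z, q (s z) = z := fun z => (hs z).choose_spec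
  have hsq : ∀ p, s (q p) = p ∨ q p = C.pt := fun p =>
    (hq.eq_or (s (q p)) p (hqs (q p))).imp id fun h => (hqs (q p)).symm.trans h
  have hw : ∀ p, N.w (s (q p)) = N.w p := fun p => by
    rcases hsq p with h | h
    · rw [h]
    · rw [N.w_eq_zero p h, N.w_eq_zero _ ((hqs (q p)).trans h)]
  have hh : ∀ p t, q (N.h (s (q p), t)) = q (N.h (p, t)) := fun p t => by
    rcases hsq p with h | h
    · rw [h]
    · rw [N.h_mem p h, N.h_mem _ ((hqs (q p)).trans h), hqs]
  refine ⟨⟨fun z => N.w (s z), fun x => q (N.h (s x.1, x.2)), ?_, ?_, fun z => N.w_nonneg _, ?_,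
    fun z => ?_, ?_, fun z t ht => N.h_arrived _ _ ht⟩⟩
  · refine hq.isQuotientMap.continuous_iff.2 (N.continuous_w.congr fun p => (hw p).symm)
  · refine hq.isQuotientMap.continuous_lift_prod_left ?_
    exact (q.cont.comp N.continuous_h).congr fun p => (hh p.1 p.2).symm
  · rintro z (rfl : z = C.pt)
    exact N.w_eq_zero _ (hqs _)
  · show q (N.h (s z, 0)) = z
    rw [N.h_zero, hqs]
  · rintro z (rfl : z = C.pt) t
    show q (N.h (s C.pt, t)) = C.pt
    rw [N.h_mem _ (hqs _), hqs]

/-- Points with different values of `w` are separated by `w`. Points with equal values are both away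
from the base point, and over the open set `w ≠ 0` the map `q` is injective and open. -/
theorem Collapse.t2Space [T2Space A] {q : PMap A C} (hq : Collapse q)
    (N : NDR ({C.pt} : Set C)) : T2Space C := by
  refine ⟨fun x y hxy => ?_⟩
  by_cases hw : N.w x = N.w y
  · have hx : N.w x ≠ 0 := fun h => hxy
      ((N.eq_pt_of_w_eq_zero h).trans (N.eq_pt_of_w_eq_zero (hw ▸ h)).symm)
    obtain ⟨a, rfl⟩ := hq.isQuotientMap.surjective x
    obtain ⟨b, rfl⟩ := hq.isQuotientMap.surjective y
    obtain ⟨U, V, hU, hV, ha, hb, hUV⟩ := t2_separation fun h : a = b => hxy (congrArg q h)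
    let O : Set A := {p | N.w (q p) ≠ 0}
    have hO : IsOpen O := isOpen_ne.preimage (N.continuous_w.comp q.cont)
    have hinj : ∀ p ∈ O, ∀ p', q p' = q p → p' = p := fun p hp p' h =>
      (hq.eq_or p' p h).resolve_right fun h' => hp (N.w_eq_zero _ (h.symm.trans h'))
    have hopen : ∀ U' : Set A, IsOpen U' → IsOpen (q '' (U' ∩ O)) := fun U' hU' => by
      refine hq.isQuotientMap.isOpen_preimage.1 ?_
      convert hU'.inter hO using 1
      ext p
      refine ⟨?_, fun h => ⟨p, h, rfl⟩⟩
      rintro ⟨p', hp', h⟩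
      rw [hinj p' hp'.2 p h.symm]
      exact hp'
    have hy : N.w (q b) ≠ 0 := hw ▸ hx
    refine ⟨_, _, hopen U hU, hopen V hV, ⟨a, ⟨ha, hx⟩, rfl⟩, ⟨b, ⟨hb, hy⟩, rfl⟩, ?_⟩
    rw [Set.disjoint_left]
    rintro _ ⟨p, hp, rfl⟩ ⟨p', hp', h⟩
    rw [hinj p hp.2 p' h] at hp'
    exact Set.disjoint_left.1 hUV hp.1 hp'.1
  · exact separated_by_continuous N.continuous_w hw

/-- The wedge is a neighbourhood deformation retract of the product. -/
noncomputable def NDR.wedge (M : NDR ({P.pt} : Set P)) (N : NDR ({Q.pt} : Set Q)) :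
    NDR {p : prod P Q | smashMk P Q p = (smash P Q).pt} where
  w p := min (M.w p.1) (N.w p.2)
  -- Each coordinate runs only until the arrival time of the other. A point of the wedge therefore
  -- stays fixed, since one coordinate has arrival time `0`; any other point stops as soon as one
  -- coordinate has had time to arrive.
  h x := KProd.mk (M.h (x.1.1, min x.2 (Set.projIcc 0 1 zero_le_one (N.w x.1.2))))
    (N.h (x.1.2, min x.2 (Set.projIcc 0 1 zero_le_one (M.w x.1.1))))
  continuous_w := (M.continuous_w.comp (prodFst P Q).cont).min
    (N.continuous_w.comp (prodSnd P Q).cont)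
  continuous_h := KProd.continuous_prod_dom fun S _ _ _ a b ha hb => by
    have ha' : Continuous fun p : S × I => a p.1 := ha.comp continuous_fst
    have hb' : Continuous fun p : S × I => b p.1 := hb.comp continuous_fst
    exact KProd.continuous_test (S := S × I)
      (M.continuous_h.comp (ha'.prodMk (continuous_snd.min
        (continuous_projIcc.comp (N.continuous_w.comp hb')))))
      (N.continuous_h.comp (hb'.prodMk (continuous_snd.min
        (continuous_projIcc.comp (M.continuous_w.comp ha')))))
  w_nonneg p := le_min (M.w_nonneg _) (N.w_nonneg _)
  w_eq_zero p hp := by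
    rcases smashMk_eq_pt_iff.1 hp with h | h
    · rw [M.w_eq_zero _ h, min_eq_left (N.w_nonneg _)]
    · rw [N.w_eq_zero _ h, min_eq_right (M.w_nonneg _)]
  h_zero p := by
    have h0 : ∀ t : I, min 0 t = 0 := fun t => min_eq_left t.2.1
    exact Prod.ext ((congrArg (fun t => M.h (p.1, t)) (h0 _)).trans (M.h_zero _))
      ((congrArg (fun t => N.h (p.2, t)) (h0 _)).trans (N.h_zero _))
  h_mem p hp t := by
    rcases smashMk_eq_pt_iff.1 hp with h | h
    · refine Prod.ext (M.h_mem _ h _) ?_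
      show N.h (p.2, min t (Set.projIcc 0 1 zero_le_one (M.w p.1))) = p.2
      rw [M.w_eq_zero _ h, Set.projIcc_left]
      exact (congrArg (fun s => N.h (p.2, s)) (min_eq_right t.2.1)).trans (N.h_zero _)
    · refine Prod.ext ?_ (N.h_mem _ h _)
      show M.h (p.1, min t (Set.projIcc 0 1 zero_le_one (N.w p.2))) = p.1
      rw [N.w_eq_zero _ h, Set.projIcc_left]
      exact (congrArg (fun s => M.h (p.1, s)) (min_eq_right t.2.1)).trans (M.h_zero _)
  h_arrived p t ht := by
    have key : ∀ {r s : ℝ}, r ≤ s → r ≤ t →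
        r ≤ (min t (Set.projIcc 0 1 zero_le_one s) : I) := fun {r s} hrs hrt => by
      have h : r ≤ (Set.projIcc 0 1 zero_le_one s : I) := by
        rw [Set.coe_projIcc]
        exact le_max_of_le_right (le_min (hrt.trans t.2.2) hrs)
      rcases min_choice t (Set.projIcc 0 1 zero_le_one s) with e | e <;> rw [e] <;> assumption
    refine smashMk_eq_pt_iff.2 ?_
    rcases le_total (M.w p.1) (N.w p.2) with h | h
    · exact Or.inl (M.h_arrived _ _ (key h ((min_eq_left h).symm.le.trans ht)))
    · exact Or.inr (N.h_arrived _ _ (key h ((min_eq_right h).symm.le.trans ht)))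

/-- The product of well-pointed spaces is well-pointed. -/
noncomputable def NDR.prod (M : NDR ({P.pt} : Set P)) (N : NDR ({Q.pt} : Set Q)) :
    NDR ({(prod P Q).pt} : Set (prod P Q)) where
  w p := max (M.w p.1) (N.w p.2)
  h x := KProd.mk (M.h (x.1.1, x.2)) (N.h (x.1.2, x.2))
  continuous_w := (M.continuous_w.comp (prodFst P Q).cont).max
    (N.continuous_w.comp (prodSnd P Q).cont)
  continuous_h := KProd.continuous_prod_dom fun S _ _ _ a b ha hb =>
    KProd.continuous_test (S := S × I)
      (M.continuous_h.comp ((ha.comp continuous_fst).prodMk continuous_snd))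
      (N.continuous_h.comp ((hb.comp continuous_fst).prodMk continuous_snd))
  w_nonneg p := le_max_of_le_left (M.w_nonneg _)
  w_eq_zero := by
    rintro _ rfl
    show max (M.w P.pt) (N.w Q.pt) = 0
    rw [M.w_eq_zero _ rfl, N.w_eq_zero _ rfl, max_self]
  h_zero p := Prod.ext (M.h_zero _) (N.h_zero _)
  h_mem := by
    rintro _ rfl t
    exact Prod.ext (M.h_mem _ rfl _) (N.h_mem _ rfl _)
  h_arrived p t ht := Prod.ext (M.h_arrived _ _ ((le_max_left _ _).trans ht))
    (N.h_arrived _ _ ((le_max_right _ _).trans ht))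

/-- A disjoint base point. -/
noncomputable def NDR.plus (V : Type u) [TopologicalSpace V] :
    NDR ({(plus V).pt} : Set (plus V)) where
  -- The value `2` lies beyond every time in `I`: points of `V` never arrive.
  w := Sum.elim (fun _ => 2) (fun _ => 0)
  h x := x.1
  continuous_w := continuous_const.sumElim continuous_const
  continuous_h := continuous_fst
  w_nonneg := by rintro (_ | _) <;> simp
  w_eq_zero := by rintro _ rfl; rfl
  h_zero _ := rfl
  h_mem _ _ _ := rfl
  h_arrived := by
    rintro (p | p) t ht
    · have := t.2.2
      simp only [Sum.elim_inl] at ht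
      linarith
    · rfl

/-- The projection `W ⊔ * → W`. -/
def plusId (W : PTop.{u}) : PMap (plus W) W := plusLift (ContinuousMap.id W)

/-- The fibre `S⁰` of `W ⊔ * → W`. -/
noncomputable def NDR.plusId (M : NDR ({W.pt} : Set W)) : NDR {p | plusId W p = W.pt} where
  w := Sum.elim M.w (fun _ => 0)
  h x := Sum.elim (fun y : W × I => Sum.inl (M.h y)) (fun y : PUnit × I => Sum.inr y.1)
    (Homeomorph.sumProdDistrib x)
  continuous_w := M.continuous_w.sumElim continuous_const
  continuous_h := ((continuous_inl.comp M.continuous_h).sumElim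
    (continuous_inr.comp continuous_fst)).comp Homeomorph.sumProdDistrib.continuous
  w_nonneg := by
    rintro (p | p)
    · exact M.w_nonneg p
    · exact le_rfl
  w_eq_zero := by
    rintro (p | p) hp
    · exact M.w_eq_zero p hp
    · rfl
  h_zero := by
    rintro (p | p)
    · exact congrArg Sum.inl (M.h_zero p)
    · rfl
  h_mem := by
    rintro (p | p) hp t
    · exact congrArg Sum.inl (M.h_mem p hp t)
    · rfl
  h_arrived := by
    rintro (p | p) t ht
    · exact M.h_arrived p t ht
    · rfl

theorem collapse_smashMk (P Q : PTop.{u}) : Collapse (smashMk P Q) where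
  isQuotientMap := isQuotientMap_smashMk P Q
  eq_or _ _ h := (smashMk_eq_iff.1 h).imp id fun h => smashMk_eq_pt h.1

theorem collapse_plusId (W : PTop.{u}) : Collapse (plusId W) where
  isQuotientMap := IsQuotientMap.of_comp (f := (Sum.inl : W → plus W)) continuous_inl
    (plusId W).cont IsQuotientMap.id
  eq_or := by
    rintro (_ | _) (_ | _) h
    · exact Or.inl (congrArg Sum.inl h)
    · exact Or.inr h
    · exact Or.inr rfl
    · exact Or.inl rfl

end NDR

/-! ### Spaces of the homotopy type of a well-pointed compactly generated Hausdorff space -/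

section CGH

variable {P Q P' Q' W : PTop.{u}}

/-- Well-pointed compactly generated Hausdorff spaces. -/
structure IsCGH (P : PTop.{u}) : Prop where
  t2Space : T2Space P
  compactlyGeneratedSpace : UCompactlyGeneratedSpace.{u} P
  nonempty_ndr : Nonempty (NDR ({P.pt} : Set P))

/-- The product is Hausdorff because its topology refines the product topology. The wedge is a
neighbourhood deformation retract in it, so Hausdorffness and a nondegenerate base point pass to the
quotient. -/
theorem isCGH_smash (hP : IsCGH P) (hQ : IsCGH Q) : IsCGH (smash P Q) := by
  obtain ⟨_, _, ⟨M⟩⟩ := hP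
  obtain ⟨_, _, ⟨N⟩⟩ := hQ
  have : T2Space (prod P Q) := .of_injective_continuous (f := fun p : prod P Q => (p.1, p.2))
    (fun _ _ h => h) ((prodFst P Q).cont.prodMk (prodSnd P Q).cont)
  have K := (M.wedge N).collapse (collapse_smashMk P Q)
  exact ⟨(collapse_smashMk P Q).t2Space K.some, inferInstance, K⟩

theorem isCGH_prod (hP : IsCGH P) (hQ : IsCGH Q) : IsCGH (prod P Q) := by
  obtain ⟨_, _, ⟨M⟩⟩ := hP
  obtain ⟨_, _, ⟨N⟩⟩ := hQ
  exact ⟨.of_injective_continuous (f := fun p : KProd P Q => (p.1, p.2))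
    (fun _ _ h => h) ((prodFst P Q).cont.prodMk (prodSnd P Q).cont), inferInstance, ⟨M.prod N⟩⟩

instance {V : Type u} [TopologicalSpace V] [UCompactlyGeneratedSpace.{u} V] :
    UCompactlyGeneratedSpace.{u} (plus V) :=
  inferInstanceAs (UCompactlyGeneratedSpace.{u} (V ⊕ PUnit.{u + 1}))

theorem isCGH_plus (hP : IsCGH P) : IsCGH (plus P) := by
  obtain ⟨_, _, -⟩ := hP
  exact ⟨inferInstanceAs (T2Space (P ⊕ PUnit.{u + 1})), inferInstance, ⟨NDR.plus P⟩⟩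

theorem hasCGHType_iff : HasCGHType P ↔ ∃ P' : PTop.{u}, IsCGH P' ∧ PHomotopyEquivalent P P' :=
  ⟨fun ⟨P', h1, h2, h3, h⟩ => ⟨P', ⟨h1, h2, h3.nonempty_ndr⟩, h⟩,
    fun ⟨P', ⟨h1, h2, ⟨N⟩⟩, h⟩ => ⟨P', h1, h2, N.wellPointed, h⟩⟩

theorem PMap.Homotopic.trans {X : PTop.{u}} {Y : PTop.{v}} {f g h : PMap X Y}
    (hf : f.Homotopic g) (hg : g.Homotopic h) : f.Homotopic h :=
  (PMap.setoid X Y).iseqv.trans hf hg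

theorem PHomotopyEquivalent.smash (hP : PHomotopyEquivalent P P')
    (hQ : PHomotopyEquivalent Q Q') : PHomotopyEquivalent (smash P Q) (smash P' Q') := by
  obtain ⟨f, g, h, h'⟩ := hP
  obtain ⟨k, l, m, m'⟩ := hQ
  refine ⟨smashMap f k, smashMap g l, ?_, ?_⟩
  · have := (smashMap_homotopic h (l.comp k)).trans (smashMap_homotopic_right _ m)
    convert this using 1 <;> exact smash_ext fun _ _ => rfl
  · have := (smashMap_homotopic h' (k.comp l)).trans (smashMap_homotopic_right _ m')
    convert this using 1 <;> exact smash_ext fun _ _ => rfl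

theorem prodMap_homotopic {f f' : PMap P P'} {g g' : PMap Q Q'} (hf : f.Homotopic f')
    (hg : g.Homotopic g') : (prodMap f g).Homotopic (prodMap f' g') := by
  obtain ⟨H, hH, h0, h1, hp⟩ := PMap.homotopic_iff.1 hf
  obtain ⟨K, hK, k0, k1, kp⟩ := PMap.homotopic_iff.1 hg
  refine PMap.homotopic_iff.2 ⟨fun x => KProd.mk (H (x.1, x.2.1)) (K (x.1, x.2.2)), ?_,
    fun x => Prod.ext (h0 _) (k0 _), fun x => Prod.ext (h1 _) (k1 _),
    fun t => Prod.ext (hp t) (kp t)⟩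
  refine (KProd.continuous_prod_dom
    (f := fun x : KProd P Q × I => KProd.mk (H (x.2, x.1.1)) (K (x.2, x.1.2))) ?_).comp
      continuous_swap
  intro S _ _ _ a b ha hb
  exact KProd.continuous_test (S := S × I)
    (hH.comp (continuous_snd.prodMk (ha.comp continuous_fst)))
    (hK.comp (continuous_snd.prodMk (hb.comp continuous_fst)))

theorem plusMap_homotopic {f f' : PMap P P'} (hf : f.Homotopic f') :
    (plusMap f.toMap).Homotopic (plusMap f'.toMap) := by
  obtain ⟨H, hH, h0, h1, hp⟩ := PMap.homotopic_iff.1 hf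
  refine PMap.homotopic_iff.2 ⟨fun x => Sum.elim (fun y : I × P => Sum.inl (H y))
    (fun y => Sum.inr y.2) (Homeomorph.prodSumDistrib x), ?_, ?_, ?_, fun t => rfl⟩
  · exact ((continuous_inl.comp hH).sumElim (continuous_inr.comp continuous_snd)).comp
      Homeomorph.prodSumDistrib.continuous
  · rintro (x | x)
    · exact congrArg Sum.inl (h0 x)
    · rfl
  · rintro (x | x)
    · exact congrArg Sum.inl (h1 x)
    · rfl

theorem plus_ext {V : Type u} [TopologicalSpace V] {X : PTop.{v}} {f g : PMap (plus V) X}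
    (h : ∀ x, f (Sum.inl x) = g (Sum.inl x)) : f = g :=
  PMap.ext_fun (by
    rintro (x | x)
    · exact h x
    · exact f.map_pt.trans g.map_pt.symm)

theorem hasCGHType_smash (hP : HasCGHType P) (hQ : HasCGHType Q) : HasCGHType (smash P Q) := by
  obtain ⟨P', hP', e⟩ := hasCGHType_iff.1 hP
  obtain ⟨Q', hQ', e'⟩ := hasCGHType_iff.1 hQ
  exact hasCGHType_iff.2 ⟨_, isCGH_smash hP' hQ', e.smash e'⟩

theorem hasCGHType_prod (hP : HasCGHType P) (hQ : HasCGHType Q) : HasCGHType (prod P Q) := by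
  obtain ⟨P', hP', f, g, h, h'⟩ := hasCGHType_iff.1 hP
  obtain ⟨Q', hQ', k, l, m, m'⟩ := hasCGHType_iff.1 hQ
  exact hasCGHType_iff.2 ⟨_, isCGH_prod hP' hQ', prodMap f k, prodMap g l,
    prodMap_homotopic h m, prodMap_homotopic h' m'⟩

theorem hasCGHType_plus (hP : HasCGHType P) : HasCGHType (plus P) := by
  obtain ⟨P', hP', f, g, h, h'⟩ := hasCGHType_iff.1 hP
  refine hasCGHType_iff.2 ⟨_, isCGH_plus hP', plusMap f.toMap, plusMap g.toMap, ?_, ?_⟩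
  · convert plusMap_homotopic h using 1 <;> exact plus_ext fun _ => rfl
  · convert plusMap_homotopic h' using 1 <;> exact plus_ext fun _ => rfl

end CGH

/-! ### Existence and uniqueness of the products -/

section WellDefined

variable {Γ P Q W : PTop.{u}} {X : PTop.{v}}

/-- The inclusion of `P` in the wedge, for compactly generated `P`. -/
def wedgeInl (P Q : PTop.{u}) [UCompactlyGeneratedSpace.{u} P] : PMap P (fiber (smashMk P Q)) :=
  ⟨⟨fun x => ⟨KProd.mk x Q.pt, smashMk_eq_pt (Or.inr rfl)⟩,
    Continuous.subtype_mk (prodLift (PMap.id P) (PMap.const P Q)).cont _⟩, rfl⟩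

/-- The inclusion of `Q` in the wedge, for compactly generated `Q`. -/
def wedgeInr (P Q : PTop.{u}) [UCompactlyGeneratedSpace.{u} Q] : PMap Q (fiber (smashMk P Q)) :=
  ⟨⟨fun y => ⟨KProd.mk P.pt y, smashMk_eq_pt (Or.inl rfl)⟩,
    Continuous.subtype_mk (prodLift (PMap.const Q P) (PMap.id Q)).cont _⟩, rfl⟩

/-- A class on `Γ(P ∨ Q)` is determined by its restrictions to `ΓP` and `ΓQ`. -/
theorem wedge_hclass_ext [UCompactlyGeneratedSpace.{u} P] [UCompactlyGeneratedSpace.{u} Q]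
    {κ κ' : HClass (smash Γ (fiber (smashMk P Q))) X}
    (h₁ : gpull Γ (wedgeInl P Q) κ = gpull Γ (wedgeInl P Q) κ')
    (h₂ : gpull Γ (wedgeInr P Q) κ = gpull Γ (wedgeInr P Q) κ') : κ = κ' := by
  induction κ using Quotient.inductionOn with
  | h f =>
  induction κ' using Quotient.inductionOn with
  | h f' =>
  let p₁ := smashMap (PMap.id Γ) ((prodFst P Q).comp (fiberIncl (smashMk P Q)))
  let p₂ := smashMap (PMap.id Γ) ((prodSnd P Q).comp (fiberIncl (smashMk P Q)))
  obtain ⟨H, hH, H0, H1, Hp⟩ := PMap.homotopic_iff.1 (PMap.cls_eq_iff.1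
    (h₁ : (f.comp (smashMap (PMap.id Γ) (wedgeInl P Q))).cls =
      (f'.comp (smashMap (PMap.id Γ) (wedgeInl P Q))).cls))
  obtain ⟨K, hK, K0, K1, Kp⟩ := PMap.homotopic_iff.1 (PMap.cls_eq_iff.1
    (h₂ : (f.comp (smashMap (PMap.id Γ) (wedgeInr P Q))).cls =
      (f'.comp (smashMap (PMap.id Γ) (wedgeInr P Q))).cls))
  -- Every point of `Γ(P ∨ Q)` lies in one summand, is recovered from its projection there, and is
  -- killed by the other projection.
  have key : ∀ x, (p₁ x = (smash Γ P).pt ∧ smashMap (PMap.id Γ) (wedgeInr P Q) (p₂ x) = x) ∨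
      (p₂ x = (smash Γ Q).pt ∧ smashMap (PMap.id Γ) (wedgeInl P Q) (p₁ x) = x) := by
    intro x
    obtain ⟨⟨γ, ⟨⟨a, b⟩, hab⟩⟩, rfl⟩ := (isQuotientMap_smashMk Γ _).surjective x
    rcases smashMk_eq_pt_iff.1 hab with (rfl : a = P.pt) | (rfl : b = Q.pt)
    · exact Or.inl ⟨smashMk_eq_pt (p := KProd.mk γ P.pt) (Or.inr rfl), rfl⟩
    · exact Or.inr ⟨smashMk_eq_pt (p := KProd.mk γ Q.pt) (Or.inr rfl), rfl⟩
  have mem : ∀ t x, H (t, p₁ x) = X.pt ∨ K (t, p₂ x) = X.pt := fun t x =>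
    (key x).imp (fun h => by rw [h.1, Hp]) fun h => by rw [h.1, Kp]
  -- The two homotopies combine through the folding map of `X`; continuity is then that of
  -- `foldFun`, with no gluing of closed sets.
  have glue : ∀ t x (y : X), (p₁ x = (smash Γ P).pt → K (t, p₂ x) = y) →
      (p₂ x = (smash Γ Q).pt → H (t, p₁ x) = y) →
      foldFun X ⟨(H (t, p₁ x), K (t, p₂ x)), mem t x⟩ = y := fun t x y h h' => by
    rcases key x with hx | hx
    · exact (foldFun_fst ((congrArg (fun z => H (t, z)) hx.1).trans (Hp t))).trans (h hx.1)
    · exact (foldFun_snd ((congrArg (fun z => K (t, z)) hx.1).trans (Kp t))).trans (h' hx.1)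
  have eq₂ : ∀ x, p₁ x = (smash Γ P).pt → smashMap (PMap.id Γ) (wedgeInr P Q) (p₂ x) = x := by
    intro x hx
    rcases key x with h | h
    · exact h.2
    · rw [show x = (smash Γ _).pt from h.2.symm.trans ((congrArg _ hx).trans (PMap.map_pt _)),
        PMap.map_pt, PMap.map_pt]
  have eq₁ : ∀ x, p₂ x = (smash Γ Q).pt → smashMap (PMap.id Γ) (wedgeInl P Q) (p₁ x) = x := by
    intro x hx
    rcases key x with h | h
    · rw [show x = (smash Γ _).pt from h.2.symm.trans ((congrArg _ hx).trans (PMap.map_pt _)),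
        PMap.map_pt, PMap.map_pt]
    · exact h.2
  refine PMap.cls_eq_iff.2 (PMap.homotopic_iff.2
    ⟨fun z => foldFun X ⟨(H (z.1, p₁ z.2), K (z.1, p₂ z.2)), mem z.1 z.2⟩, ?_,
      fun x => glue 0 x _ (fun h => ?_) fun h => ?_,
      fun x => glue 1 x _ (fun h => ?_) fun h => ?_, fun t => glue t _ _ (fun h => ?_) fun h => ?_⟩)
  · exact (continuous_foldFun X).comp (Continuous.subtype_mk
      ((hH.comp (continuous_fst.prodMk (p₁.cont.comp continuous_snd))).prodMk
        (hK.comp (continuous_fst.prodMk (p₂.cont.comp continuous_snd)))) _)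
  · exact (K0 _).trans (congrArg f (eq₂ x h))
  · exact (H0 _).trans (congrArg f (eq₁ x h))
  · exact (K1 _).trans (congrArg f' (eq₂ x h))
  · exact (H1 _).trans (congrArg f' (eq₁ x h))
  · rw [p₂.map_pt, Kp]
  · rw [p₁.map_pt, Hp]

variable [CoGroup Γ]

/-- The extension is the product of the pullbacks of the two restrictions: over each summand one
factor is trivial. -/
theorem gpull_fiberIncl_smashMk_surjective [UCompactlyGeneratedSpace.{u} P]
    [UCompactlyGeneratedSpace.{u} Q] : Function.Surjective
      (gpull Γ (fiberIncl (smashMk P Q)) : HClass (smash Γ (prod P Q)) X → _) := by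
  intro κ
  refine ⟨gpull Γ (prodFst P Q) (gpull Γ (wedgeInl P Q) κ) *
    gpull Γ (prodSnd P Q) (gpull Γ (wedgeInr P Q) κ), wedge_hclass_ext ?_ ?_⟩
  · simp only [gpull_mul, gpull_gpull]
    rw [show (((wedgeInr P Q).comp (prodSnd P Q)).comp (fiberIncl (smashMk P Q))).comp
      (wedgeInl P Q) = PMap.const _ _ from rfl, gpull_const, mul_one]
    rfl
  · simp only [gpull_mul, gpull_gpull]
    rw [show (((wedgeInl P Q).comp (prodFst P Q)).comp (fiberIncl (smashMk P Q))).comp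
      (wedgeInr P Q) = PMap.const _ _ from rfl, gpull_const, one_mul]
    rfl

theorem IsCGH.gpull_smashMk_injective (hP : IsCGH P) (hQ : IsCGH Q) :
    Function.Injective (gpull Γ (smashMk P Q) : HClass (smash Γ (smash P Q)) X → _) := by
  obtain ⟨_, _, ⟨M⟩⟩ := hP
  obtain ⟨_, _, ⟨N⟩⟩ := hQ
  exact (collapse_smashMk P Q).gpull_injective (M.wedge N) gpull_fiberIncl_smashMk_surjective

/-- On each summand of the wedge one entry of the commutator is trivial, so the commutator dies on
the wedge and exactness applies. -/
theorem IsCGH.exists_isGammaWhitehead (hP : IsCGH P) (hQ : IsCGH Q) (μ : HClass (smash Γ P) X)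
    (ν : HClass (smash Γ Q) X) : ∃ κ, IsGammaWhitehead μ ν κ := by
  obtain ⟨_, _, ⟨M⟩⟩ := hP
  obtain ⟨_, _, ⟨N⟩⟩ := hQ
  refine (collapse_smashMk P Q).exists_gpull_eq (M.wedge N) _ (wedge_hclass_ext ?_ ?_)
  · simp only [gpull_commutator, gpull_gpull, gpull_one]
    rw [show ((prodSnd P Q).comp (fiberIncl (smashMk P Q))).comp (wedgeInl P Q) =
      PMap.const _ _ from rfl, gpull_const, commutatorElement_one_right]
  · simp only [gpull_commutator, gpull_gpull, gpull_one]
    rw [show ((prodFst P Q).comp (fiberIncl (smashMk P Q))).comp (wedgeInr P Q) =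
      PMap.const _ _ from rfl, gpull_const, commutatorElement_one_left]

/-- Pulling back along a homotopy inverse and then along the equivalence is the identity, so the
problem may be moved to the well-behaved models. -/
theorem gpull_smashMk_injective (hP : HasCGHType P) (hQ : HasCGHType Q) :
    Function.Injective (gpull Γ (smashMk P Q) : HClass (smash Γ (smash P Q)) X → _) := by
  obtain ⟨P', hP', f, g, h, -⟩ := hasCGHType_iff.1 hP
  obtain ⟨Q', hQ', k, l, m, -⟩ := hasCGHType_iff.1 hQ
  have e : ((smashMap g l).comp (smashMap f k)).Homotopic (PMap.id _) := by
    have := (smashMap_homotopic h (l.comp k)).trans (smashMap_homotopic_right _ m)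
    convert this using 1 <;> exact smash_ext fun _ _ => rfl
  intro κ κ' hκ
  rw [← gpull_gpull_of_homotopic_id e κ, ← gpull_gpull_of_homotopic_id e κ']
  refine congrArg _ (hP'.gpull_smashMk_injective hQ' ?_)
  have := congrArg (gpull Γ (prodMap g l)) hκ
  simp only [gpull_gpull] at this ⊢
  exact this

theorem exists_isGammaWhitehead (hP : HasCGHType P) (hQ : HasCGHType Q)
    (μ : HClass (smash Γ P) X) (ν : HClass (smash Γ Q) X) : ∃ κ, IsGammaWhitehead μ ν κ := by
  obtain ⟨P', hP', f, g, h, -⟩ := hasCGHType_iff.1 hP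
  obtain ⟨Q', hQ', k, l, m, -⟩ := hasCGHType_iff.1 hQ
  obtain ⟨κ, hκ⟩ := hP'.exists_isGammaWhitehead hQ' (gpull Γ g μ) (gpull Γ l ν)
  refine ⟨gpull Γ (smashMap f k) κ, ?_⟩
  have := congrArg (gpull Γ (prodMap f k)) hκ
  rw [gpull_commutator] at this
  rw [← gpull_gpull_of_homotopic_id h μ, ← gpull_gpull_of_homotopic_id m ν]
  unfold IsGammaWhitehead
  simp only [gpull_gpull] at this ⊢
  exact this

theorem existsUnique_isGammaWhitehead (hP : HasCGHType P) (hQ : HasCGHType Q)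
    (μ : HClass (smash Γ P) X) (ν : HClass (smash Γ Q) X) : ∃! κ, IsGammaWhitehead μ ν κ := by
  obtain ⟨κ, hκ⟩ := exists_isGammaWhitehead hP hQ μ ν
  exact ⟨κ, hκ, fun κ' hκ' => gpull_smashMk_injective hP hQ (hκ'.trans hκ.symm)⟩

theorem gpull_smashMk_gammaWhitehead (hP : HasCGHType P) (hQ : HasCGHType Q)
    (μ : HClass (smash Γ P) X) (ν : HClass (smash Γ Q) X) :
    gpull Γ (smashMk P Q) (gammaWhitehead μ ν) =
      ⁅gpull Γ (prodFst P Q) μ, gpull Γ (prodSnd P Q) ν⁆ := by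
  have h := exists_isGammaWhitehead hP hQ μ ν
  unfold gammaWhitehead
  rw [dif_pos h]
  exact h.choose_spec

/-- The retraction of `W ⊔ *` onto the fibre over the base point. -/
def plusRetract (W : PTop.{u}) : PMap (plus W) (fiber (plusId W)) :=
  plusLift ⟨fun _ => ⟨Sum.inl W.pt, rfl⟩, continuous_const⟩

theorem plusRetract_fiberIncl (p : fiber (plusId W)) : plusRetract W (fiberIncl _ p) = p := by
  rcases p with ⟨p | p, hp⟩
  · exact Subtype.ext (congrArg Sum.inl (hp : p = W.pt).symm)
  · rfl

/-- The fibre is an `S⁰`, and `W ⊔ *` retracts onto it, so every class on the fibre extends. -/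
theorem IsCGH.gpull_plusId_injective (hW : IsCGH W) :
    Function.Injective (gpull Γ (plusId W) : HClass (smash Γ W) X → _) := by
  obtain ⟨_, _, ⟨M⟩⟩ := hW
  refine (collapse_plusId W).gpull_injective M.plusId fun κ => ⟨gpull Γ (plusRetract W) κ, ?_⟩
  rw [gpull_gpull, show (plusRetract W).comp (fiberIncl _) = PMap.id _ from PMap.ext_fun plusRetract_fiberIncl,
    gpull_id]

theorem gpull_plusId_injective (hW : HasCGHType W) :
    Function.Injective (gpull Γ (plusId W) : HClass (smash Γ W) X → _) := by
  obtain ⟨W', hW', f, g, h, -⟩ := hasCGHType_iff.1 hW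
  intro κ κ' hκ
  rw [← gpull_gpull_of_homotopic_id h κ, ← gpull_gpull_of_homotopic_id h κ']
  refine congrArg _ (hW'.gpull_plusId_injective ?_)
  have := congrArg (gpull Γ (plusMap g.toMap)) hκ
  simp only [gpull_gpull] at this ⊢
  rw [show g.comp (plusId W') = (plusId W).comp (plusMap g.toMap) from plus_ext fun _ => rfl]
  exact this

/-- Over the fibre `S⁰` the class `η` is trivial, and the conjugate reduces to `ξ ξ⁻¹ = 1`. -/
theorem IsCGH.exists_isConjAct (hW : IsCGH W) (ξ : HClass (smash Γ S0) X)
    (η : HClass (smash Γ W) X) : ∃ ζ, IsConjAct ξ η ζ := by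
  obtain ⟨_, _, ⟨M⟩⟩ := hW
  refine (collapse_plusId W).exists_gpull_eq M.plusId _ ?_
  simp only [gpull_mul, gpull_inv, toFox, gpull_gpull]
  rw [show (plusLift (ContinuousMap.id W)).comp (fiberIncl (plusId W)) = PMap.const _ _ from
    PMap.ext_fun fun p => p.2, gpull_const, mul_one, mul_inv_cancel]

theorem exists_isConjAct (hW : HasCGHType W) (ξ : HClass (smash Γ S0) X)
    (η : HClass (smash Γ W) X) : ∃ ζ, IsConjAct ξ η ζ := by
  obtain ⟨W', hW', f, g, h, -⟩ := hasCGHType_iff.1 hW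
  obtain ⟨ζ, hζ⟩ := hW'.exists_isConjAct ξ (gpull Γ g η)
  refine ⟨gpull Γ f ζ, ?_⟩
  have key := congrArg (gpull Γ (plusMap f.toMap)) hζ
  have e₁ : (plusMap (ContinuousMap.const W' (PUnit.unit : PUnit.{u + 1}))).comp
      (plusMap f.toMap) = plusMap (ContinuousMap.const W PUnit.unit) := plus_ext fun _ => rfl
  have e₂ : (plusLift (ContinuousMap.id W')).comp (plusMap f.toMap) =
      f.comp (plusLift (ContinuousMap.id W)) := plus_ext fun _ => rfl
  have e₃ : gpull Γ f (gpull Γ g η) = η := gpull_gpull_of_homotopic_id h η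
  have e₄ : ∀ ω : HClass (smash Γ W') X, gpull Γ (plusMap f.toMap)
      (gpull Γ (plusLift (ContinuousMap.id W')) ω) =
        gpull Γ (plusLift (ContinuousMap.id W)) (gpull Γ f ω) := fun ω => by
    rw [gpull_gpull, gpull_gpull, e₂]
  have e₅ := (gpull_gpull (Γ := Γ) (plusMap f.toMap) _ ξ).trans (congrArg (fun k => gpull Γ k ξ) e₁)
  unfold toFox at key
  rw [gpull_mul, gpull_mul, gpull_inv, e₄, e₄, e₃] at key
  exact key.trans (congrArg (fun ω => ω * gpull Γ _ η * ω⁻¹) e₅)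

theorem existsUnique_isConjAct (hW : HasCGHType W) (ξ : HClass (smash Γ S0) X)
    (η : HClass (smash Γ W) X) : ∃! ζ, IsConjAct ξ η ζ := by
  obtain ⟨ζ, hζ⟩ := exists_isConjAct hW ξ η
  exact ⟨ζ, hζ, fun ζ' hζ' => gpull_plusId_injective hW (hζ'.trans hζ.symm)⟩

end WellDefined

/-! ### Threefold smash products -/

section Triple

variable {Γ A B C : PTop.{u}} {X : PTop.{v}}

/-- The map `(Γ ∧ C) ∧ D → Γ ∧ (D ∧ C)`. -/
def smashShift (Γ C D : PTop.{u}) : PMap (smash (smash Γ C) D) (smash Γ (smash D C)) :=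
  smash3Lift ((smashMk Γ (smash D C)).comp (prodLift (pr1 Γ C D)
    ((smashMk D C).comp (prodLift (pr3 Γ C D) (pr2 Γ C D))))) fun γ c d h => by
      refine smashMk_eq_pt ?_
      rcases h with h | h | h
      · exact Or.inl h
      · exact Or.inr (smashMk_eq_pt (p := KProd.mk d c) (Or.inr h))
      · exact Or.inr (smashMk_eq_pt (p := KProd.mk d c) (Or.inl h))

/-- The map of `Γ ∧ (D × C)` to `(Γ ∧ C) ∧ D`. -/
def smashUnshiftProd (Γ C D : PTop.{u}) : PMap (smash Γ (prod D C)) (smash (smash Γ C) D) :=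
  smashLift ((smash3Mk Γ C D).comp (prodLift (prodLift (prodFst _ _)
    ((prodSnd D C).comp (prodSnd _ _))) ((prodFst D C).comp (prodSnd _ _)))) fun p h =>
      smash3Mk_eq_pt (a := p.1) (b := p.2.2) (c := p.2.1)
        (h.imp id fun h => Or.inl (congrArg (fun q : prod D C => q.2) h))

/-- `smashShift` has a right inverse. -/
theorem exists_smashShift_comp_eq_id (Γ C D : PTop.{u}) :
    ∃ f : PMap (smash Γ (smash D C)) (smash (smash Γ C) D), (smashShift Γ C D).comp f =
      PMap.id _ := by
  have Q := isQuotientMap_smashMap_id Γ (isQuotientMap_smashMk D C)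
  have hl : Function.FactorsThrough (smashUnshiftProd Γ C D)
      (smashMap (PMap.id Γ) (smashMk D C)) := fun x x' h =>
    (collapse_smashMk D C).factors (y := (smash (smash Γ C) D).pt) (fun x => by
      obtain ⟨⟨γ, ⟨⟨d, c⟩, hp⟩⟩, rfl⟩ := (isQuotientMap_smashMk Γ _).surjective x
      refine smash3Mk_eq_pt (a := γ) (b := c) (c := d) ?_
      rcases smashMk_eq_pt_iff.1 hp with h | h
      · exact Or.inr (Or.inr h)
      · exact Or.inr (Or.inl h)) h
  let g := Q.lift (f := (smashMap (PMap.id Γ) (smashMk D C)).toMap)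
    (smashUnshiftProd Γ C D).toMap hl
  have hg : ∀ x, g (smashMap (PMap.id Γ) (smashMk D C) x) = smashUnshiftProd Γ C D x := fun x =>
    congrArg (fun k : C(smash Γ (prod D C), smash (smash Γ C) D) => k x)
      (Q.lift_comp (smashUnshiftProd Γ C D).toMap hl)
  refine ⟨⟨g, ?_⟩, PMap.ext_fun fun z => ?_⟩
  · rw [← (smashMap (PMap.id Γ) (smashMk D C)).map_pt, hg, PMap.map_pt]
  · obtain ⟨x, rfl⟩ := Q.surjective z
    show smashShift Γ C D (g _) = _
    rw [hg]
    obtain ⟨x, rfl⟩ := (isQuotientMap_smashMk Γ _).surjective x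
    rfl

/-- Moving `C` next to `Γ` turns the claim into the case of two factors for the co-grouplike space
`Γ ∧ C`. Nothing is required of `C`, and a one-sided inverse of the shift is enough. -/
theorem gpull_smashMap_smashMk_injective [CoGroup Γ] (hA : HasCGHType A) (hB : HasCGHType B) :
    Function.Injective (gpull Γ (smashMap (smashMk A B) (PMap.id C)) :
      HClass (smash Γ (smash (smash A B) C)) X → _) := by
  intro κ κ' h
  obtain ⟨f, hf⟩ := exists_smashShift_comp_eq_id Γ C (smash A B)
  have key : HClass.pull (smashShift Γ C (smash A B)) κ =
      HClass.pull (smashShift Γ C (smash A B)) κ' := by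
    refine gpull_smashMk_injective (Γ := smash Γ C) hA hB ?_
    have := congrArg (HClass.pull (smashShift Γ C (prod A B))) h
    unfold gpull at this ⊢
    rw [HClass.pull_comp, HClass.pull_comp] at this ⊢
    rw [show (smashShift Γ C (smash A B)).comp
      (smashMap (PMap.id (smash Γ C)) (smashMk A B)) =
        (smashMap (PMap.id Γ) (smashMap (smashMk A B) (PMap.id C))).comp
          (smashShift Γ C (prod A B)) from PMap.ext_fun fun x => by
        obtain ⟨⟨x, p⟩, rfl⟩ := (isQuotientMap_smashMk _ _).surjective x
        obtain ⟨x, rfl⟩ := (isQuotientMap_smashMk _ _).surjective x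
        rfl]
    exact this
  have := congrArg (HClass.pull f) key
  rwa [HClass.pull_comp, HClass.pull_comp, hf, HClass.pull_id, HClass.pull_id] at this

/-- Collapse in two stages, `(A × B) × C → (A × B) ∧ C → (A ∧ B) ∧ C`. Identities on the smash
product may thus be checked on the product. -/
theorem gpull_smash3Mk_injective [CoGroup Γ] (hA : HasCGHType A) (hB : HasCGHType B)
    (hC : HasCGHType C) : Function.Injective (gpull Γ (smash3Mk A B C) :
      HClass (smash Γ (smash (smash A B) C)) X → _) := by
  intro κ κ' h
  refine gpull_smashMap_smashMk_injective hA hB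
    (gpull_smashMk_injective (hasCGHType_prod hA hB) hC ?_)
  rw [gpull_gpull, gpull_gpull]
  exact h

theorem gpull_smash3Mk_gammaWhitehead [CoGroup Γ] (hA : HasCGHType A) (hB : HasCGHType B)
    (hC : HasCGHType C) (α : HClass (smash Γ A) X) (β : HClass (smash Γ B) X)
    (γ : HClass (smash Γ C) X) :
    gpull Γ (smash3Mk A B C) (gammaWhitehead (gammaWhitehead α β) γ) =
      ⁅⁅gpull Γ (pr1 A B C) α, gpull Γ (pr2 A B C) β⁆, gpull Γ (pr3 A B C) γ⁆ := by
  unfold smash3Mk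
  rw [← gpull_gpull, gpull_smashMk_gammaWhitehead (hasCGHType_smash hA hB) hC, gpull_commutator,
    gpull_gpull, gpull_gpull]
  rw [show (prodFst (smash A B) C).comp (prodMap (smashMk A B) (PMap.id C)) =
    (smashMk A B).comp (prodFst _ C) from rfl, ← gpull_gpull,
    gpull_smashMk_gammaWhitehead hA hB, gpull_commutator, gpull_gpull, gpull_gpull]
  rfl

/-- The map `(A × B) ⊔ * → (A ⊔ *) × (B ⊔ *)`. -/
def plusPair (A B : PTop.{u}) : PMap (plus (prod A B)) (prod (plus A) (plus B)) :=
  plusLift ⟨fun p => KProd.mk (Sum.inl p.1) (Sum.inl p.2), KProd.continuous_mk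
    (continuous_inl.comp (prodFst A B).cont) (continuous_inl.comp (prodSnd A B).cont)⟩

/-- With disjoint base points the smash product is a product again, so here the Whitehead product is
itself a commutator. -/
theorem foxWhitehead_eq [CoGroup Γ] (hA : HasCGHType A) (hB : HasCGHType B)
    (a : FoxGroup Γ A X) (b : FoxGroup Γ B X) : foxWhitehead a b =
      ⁅gpull Γ (plusMap (prodFst A B).toMap) a, gpull Γ (plusMap (prodSnd A B).toMap) b⁆ := by
  unfold foxWhitehead
  rw [show plusProd A B = (smashMk (plus A) (plus B)).comp (plusPair A B) from
      plus_ext fun _ => rfl, ← gpull_gpull,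
    gpull_smashMk_gammaWhitehead (hasCGHType_plus hA) (hasCGHType_plus hB), gpull_commutator,
    gpull_gpull, gpull_gpull,
    show (prodFst (plus A) (plus B)).comp (plusPair A B) = plusMap (prodFst A B).toMap from
      plus_ext fun _ => rfl,
    show (prodSnd (plus A) (plus B)).comp (plusPair A B) = plusMap (prodSnd A B).toMap from
      plus_ext fun _ => rfl]

theorem foxWhitehead_foxWhitehead [CoGroup Γ] (hA : HasCGHType A) (hB : HasCGHType B)
    (hC : HasCGHType C) (a : FoxGroup Γ A X) (b : FoxGroup Γ B X) (c : FoxGroup Γ C X) :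
    foxWhitehead (foxWhitehead a b) c =
      ⁅⁅gpull Γ (plusMap (pr1 A B C).toMap) a, gpull Γ (plusMap (pr2 A B C).toMap) b⁆,
        gpull Γ (plusMap (pr3 A B C).toMap) c⁆ := by
  rw [foxWhitehead_eq (hasCGHType_prod hA hB) hC, foxWhitehead_eq hA hB, gpull_commutator,
    gpull_gpull, gpull_gpull,
    show (plusMap (prodFst A B).toMap).comp (plusMap (prodFst (prod A B) C).toMap) =
      plusMap (pr1 A B C).toMap from plus_ext fun _ => rfl,
    show (plusMap (prodSnd A B).toMap).comp (plusMap (prodFst (prod A B) C).toMap) =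
      plusMap (pr2 A B C).toMap from plus_ext fun _ => rfl]
  rfl

theorem gpull_plusMap_toFox {V : Type u} [TopologicalSpace V] (k : C(V, A)) (f : C(A, B))
    (α : HClass (smash Γ B) X) :
    gpull Γ (plusMap k) (toFox Γ f α) = toFox Γ (f.comp k) α := by
  unfold toFox
  rw [gpull_gpull]
  exact congrArg (fun k => gpull Γ k α) (plus_ext fun _ => rfl)

theorem toFox_eq_gpull (f : PMap A B) (α : HClass (smash Γ B) X) :
    toFox Γ f.toMap α = gpull Γ (plusId A) (gpull Γ f α) := by
  unfold toFox
  rw [gpull_gpull]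
  exact congrArg (fun k => gpull Γ k α) (PMap.ext_fun (by
    rintro (x | x)
    · rfl
    · exact f.map_pt.symm))

/-- The iterated product of images is the image of the iterated `Γ`-Whitehead product. -/
theorem foxWhitehead_toFox [CoGroup Γ] (hA : HasCGHType A) (hB : HasCGHType B)
    (hC : HasCGHType C) (α : HClass (smash Γ A) X) (β : HClass (smash Γ B) X)
    (γ : HClass (smash Γ C) X) :
    foxWhitehead (foxWhitehead (toFox Γ (ContinuousMap.id A) α) (toFox Γ (ContinuousMap.id B) β))
      (toFox Γ (ContinuousMap.id C) γ) =
        toFox Γ (smash3Mk A B C).toMap (gammaWhitehead (gammaWhitehead α β) γ) := by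
  rw [foxWhitehead_foxWhitehead hA hB hC, toFox_eq_gpull, gpull_smash3Mk_gammaWhitehead hA hB hC,
    gpull_plusMap_toFox, gpull_plusMap_toFox, gpull_plusMap_toFox, gpull_commutator,
    gpull_commutator, ← toFox_eq_gpull, ← toFox_eq_gpull, ← toFox_eq_gpull]
  rfl

theorem toFox_inv [CoGroup Γ] {V : Type u} [TopologicalSpace V] (f : C(V, A))
    (α : HClass (smash Γ A) X) : toFox Γ f α⁻¹ = (toFox Γ f α)⁻¹ := gpull_inv _ _

end Triple

/-! ### Identities in groups -/

theorem hall_witt {G : Type*} [_root_.Group G] (a b c : G) :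
    b * ⁅⁅b⁻¹, a⁆, c⁆ * b⁻¹ * (c * ⁅⁅c⁻¹, b⁆, a⁆ * c⁻¹) * (a * ⁅⁅a⁻¹, c⁆, b⁆ * a⁻¹) = 1 := by
  simp only [commutatorElement_def]
  group

/-- In general the left side is the conjugate of `⁅a, b⁆` by `b⁻¹`. -/
theorem commutatorElement_inv_eq {G : Type*} [_root_.Group G] {a b : G} (h : Commute b ⁅a, b⁆) :
    ⁅b⁻¹, a⁆ = ⁅a, b⁆ := by
  have : ⁅b⁻¹, a⁆ = b⁻¹ * ⁅a, b⁆ * b := by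
    simp only [commutatorElement_def]
    group
  rw [this, h.inv_left.eq, inv_mul_cancel_right]

/-- The first six hypotheses remove the inverses and the conjugations from Hall-Witt; the last one
interchanges two factors to reach the cyclic order of the Jacobi identity. -/
theorem jacobi_of_commute {G : Type*} [_root_.Group G] {a b c : G} (h₁ : Commute b ⁅a, b⁆)
    (h₂ : Commute c ⁅b, c⁆) (h₃ : Commute a ⁅c, a⁆) (k₁ : Commute b ⁅⁅a, b⁆, c⁆)
    (k₂ : Commute c ⁅⁅b, c⁆, a⁆) (k₃ : Commute a ⁅⁅c, a⁆, b⁆)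
    (l : Commute ⁅⁅c, a⁆, b⁆ ⁅⁅b, c⁆, a⁆) : ⁅⁅a, b⁆, c⁆ * ⁅⁅c, a⁆, b⁆ * ⁅⁅b, c⁆, a⁆ = 1 := by
  have key := hall_witt a b c
  rw [commutatorElement_inv_eq h₁, commutatorElement_inv_eq h₂, commutatorElement_inv_eq h₃,
    k₁.eq, k₂.eq, k₃.eq, mul_inv_cancel_right, mul_inv_cancel_right, mul_inv_cancel_right] at key
  rw [mul_assoc, l.eq, ← mul_assoc, key]

/-! ### Co-commutativity -/

section Cocommutative

variable {Γ B T W Z Z' : PTop.{u}} {X : PTop.{v}}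

theorem HomotopyCocommutative.commute [CoGroup Z] (h : HomotopyCocommutative Z)
    (κ ν : HClass Z X) : Commute κ ν := by
  induction κ using Quotient.inductionOn with
  | h f =>
  induction ν using Quotient.inductionOn with
  | h g =>
  have e : (copair f g).comp ((wedgeSwap Z Z).comp CoGroup.comul) = mulMap g f := by
    refine PMap.ext_fun fun z => ?_
    show copair f g (wedgeSwap Z Z (CoGroup.comul z)) = copair g f (CoGroup.comul z)
    generalize (CoGroup.comul z : wedge Z Z) = p
    rcases p.2 with hp | hp
    · rw [copair_right _ _ hp, copair_left _ _ (by exact hp)]; rfl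
    · rw [copair_left _ _ hp, copair_right _ _ (by exact hp)]; rfl
  have key := (PMap.Homotopic.refl (copair f g)).comp h
  rw [e] at key
  exact (PMap.cls_eq_iff.2 key : (mulMap g f).cls = (mulMap f g).cls).symm

/-- Smashing the given homotopy with `V` suffices, as the interchange of summands is compatible with
distributivity. -/
theorem HomotopyCocommutative.smash_right [CoGroup Z] (h : HomotopyCocommutative Z)
    (V : PTop.{u}) : HomotopyCocommutative (smash Z V) := by
  have key := (PMap.Homotopic.refl (smashDistrib Z Z V)).comp (smashMap_homotopic h (PMap.id V))
  unfold HomotopyCocommutative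
  convert key using 1
  · exact smash_ext fun _ _ => rfl
  · rfl

/-- The map `Γ(B × T) → (ΓB) ∧ (T ⊔ *)`. -/
def toHalfSmash (Γ B T : PTop.{u}) : PMap (smash Γ (prod B T)) (smash (smash Γ B) (plus T)) :=
  smashLift ⟨⟨fun p => smash3Mk Γ B (plus T) (KProd.mk (KProd.mk p.1 p.2.1) (Sum.inl p.2.2)),
    (smash3Mk Γ B (plus T)).cont.comp (KProd.continuous_mk
      (KProd.continuous_mk (prodFst Γ _).cont ((prodFst B T).comp (prodSnd Γ _)).cont)
      (continuous_inl.comp ((prodSnd B T).comp (prodSnd Γ _)).cont))⟩,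
    smash3Mk_eq_pt (Or.inl rfl)⟩ fun p h => smash3Mk_eq_pt (a := p.1) (b := p.2.1)
      (h.imp id fun h => Or.inl (congrArg (fun q : prod B T => q.1) h))

theorem isCoHom_toHalfSmash [CoGroup Γ] : IsCoHom (toHalfSmash Γ B T) :=
  smash_ext fun _ _ => rfl

/-- The extension of a map on `B × T` to `B × (T ⊔ *)`, constant on the added part. -/
def extendPlus (k : PMap (prod B T) Z) : PMap (prod B (plus T)) Z :=
  ⟨⟨fun p => Sum.elim (fun t => k (KProd.mk p.1 t)) (fun _ => Z.pt) p.2, by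
    refine KProd.continuous_dom fun S _ _ _ a v ha hv => ?_
    show Continuous fun s => Sum.elim (fun t => k (KProd.mk (a s) t)) (fun _ => Z.pt) (v s)
    -- Both parts of `T ⊔ *` are closed, so the test space falls into two closed pieces; on this
    -- one, again compact, the given map `k` applies.
    let U : Set S := v ⁻¹' Set.range Sum.inl
    have hU : IsClosed U := isClosed_range_inl.preimage hv
    have hU' : IsClosed (v ⁻¹' Set.range Sum.inr) := isClosed_range_inr.preimage hv
    rw [← continuousOn_univ, show (Set.univ : Set S) = U ∪ v ⁻¹' Set.range Sum.inr from
      (Set.eq_univ_of_forall fun s => by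
        rcases hs : v s with t | t
        · exact Or.inl ⟨t, hs.symm⟩
        · exact Or.inr ⟨t, hs.symm⟩).symm]
    refine ContinuousOn.union_of_isClosed ?_ ?_ hU hU'
    · rw [continuousOn_iff_continuous_domRestrict]
      have : CompactSpace U := isCompact_iff_compactSpace.1 hU.isCompact
      choose t ht using fun s : U => s.2
      have hvt : Continuous fun s : U => v s := hv.comp continuous_subtype_val
      have ht' : Continuous t := IsEmbedding.inl.continuous_iff.2 (hvt.congr fun s => (ht s).symm)
      refine (k.cont.comp (KProd.continuous_test (S := U)
        (ha.comp continuous_subtype_val) ht')).congr fun s => ?_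
      show k (KProd.mk (a s) (t s)) = Sum.elim _ _ (v s)
      rw [← ht s]
      rfl
    · refine (continuousOn_const (c := Z.pt)).congr fun s hs => ?_
      obtain ⟨y, hy⟩ := hs
      show Sum.elim _ _ (v s) = _
      rw [← hy]
      rfl⟩, rfl⟩

/-- The map of `(ΓB) ∧ (T ⊔ *)` to `ΓZ` that is induced by a map of `B × T` to `Z`. -/
def ofHalfSmash (Γ : PTop.{u}) (k : PMap (prod B T) Z)
    (hk : ∀ t, k (KProd.mk B.pt t) = Z.pt) : PMap (smash (smash Γ B) (plus T)) (smash Γ Z) :=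
  smash3Lift ((smashMk Γ Z).comp (prodLift (pr1 Γ B (plus T))
    ((extendPlus k).comp (prodLift (pr2 Γ B (plus T)) (pr3 Γ B (plus T)))))) fun γ b t h => by
      refine smashMk_eq_pt (p := KProd.mk γ (extendPlus k (KProd.mk b t))) ?_
      rcases h with h | h | h
      · exact Or.inl h
      · subst h
        rcases t with t | t
        · exact Or.inr (hk t)
        · exact Or.inr rfl
      · subst h
        exact Or.inr rfl

/-- Vanishing over the base point of `B` is what lets `k` factor through `ΓB ∧ (T ⊔ *)`. This places
the class in a group that is abelian as soon as `ΓB` is co-commutative. -/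
theorem gpull_eq_pull_toHalfSmash (k : PMap (prod B T) Z)
    (hk : ∀ t, k (KProd.mk B.pt t) = Z.pt) (ζ : HClass (smash Γ Z) X) :
    gpull Γ k ζ = HClass.pull (toHalfSmash Γ B T) (HClass.pull (ofHalfSmash Γ k hk) ζ) := by
  rw [HClass.pull_comp]
  exact congrArg (fun k => HClass.pull k ζ) (smash_ext fun _ _ => rfl)

/-- If `ΓB` is co-commutative, then classes on `Γ(B × T)` that are trivial over the base point of
`B` commute. -/
theorem HomotopyCocommutative.commute_gpull [CoGroup Γ] (h : HomotopyCocommutative (smash Γ B))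
    (k : PMap (prod B T) Z) (hk : ∀ t, k (KProd.mk B.pt t) = Z.pt)
    (k' : PMap (prod B T) Z') (hk' : ∀ t, k' (KProd.mk B.pt t) = Z'.pt)
    (ζ : HClass (smash Γ Z) X) (ζ' : HClass (smash Γ Z') X) :
    Commute (gpull Γ k ζ) (gpull Γ k' ζ') := by
  rw [gpull_eq_pull_toHalfSmash k hk, gpull_eq_pull_toHalfSmash k' hk']
  unfold Commute SemiconjBy
  rw [← isCoHom_toHalfSmash.pull_mul, ← isCoHom_toHalfSmash.pull_mul,
    ((h.smash_right (plus T)).commute _ _).eq]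

theorem continuous_sumElim_of_continuous {V : Type u} {Y : Type v} [TopologicalSpace V]
    [TopologicalSpace Y] {s : V → PUnit.{u + 1} ⊕ PUnit.{u + 1}} (hs : Continuous s) {f g : V → Y}
    (hf : Continuous f) (hg : Continuous g) :
    Continuous fun x => Sum.elim (fun _ => f x) (fun _ => g x) (s x) := by
  have := ((hf.comp continuous_fst).sumElim (hg.comp continuous_fst)).comp
    ((Homeomorph.prodSumDistrib (X := V) (Y := PUnit.{u + 1}) (Z := PUnit.{u + 1})).continuous.comp
      (continuous_id.prodMk hs))
  refine this.congr fun x => ?_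
  show Sum.elim _ _ (Homeomorph.prodSumDistrib (x, s x)) = _
  rcases s x with y | y <;> rfl

/-- The operation `β · η` becomes conjugation by `β` over `B × T`. -/
theorem gpull_dotAct [CoGroup Γ] (h : HomotopyCocommutative (smash Γ B) ∨ IsS0 B)
    (hW : HasCGHType W) (k : PMap (prod B T) W) (hk : ∀ t, k (KProd.mk B.pt t) = W.pt)
    (β : HClass (smash Γ B) X) (η : HClass (smash Γ W) X) :
    gpull Γ k (dotAct β η) =
      gpull Γ (prodFst B T) β * gpull Γ k η * (gpull Γ (prodFst B T) β)⁻¹ := by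
  unfold dotAct
  split_ifs with hS
  · generalize_proofs he he'
    have hpt : hS.choose S0.pt = B.pt := hS.choose_spec
    -- The argument works for any pointed homeomorphism with `S⁰`, so the chosen one can be
    -- forgotten.
    generalize hS.choose = e at *
    let ε : PMap S0 B := ⟨⟨e, he⟩, he'⟩
    have hpt' : e.symm B.pt = Sum.inr PUnit.unit := by
      rw [← hpt, Homeomorph.symm_apply_apply]; rfl
    -- For `B = S⁰` the product consists of two copies of `T`. The copy over the base point, where
    -- `k` is trivial, goes to the added point and the other copy to `W` by `k`. Pulling back along
    -- `θ` turns the defining relation of the action into the claim.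
    let θ : PMap (prod B T) (plus W) :=
      ⟨⟨fun p => Sum.elim (fun _ => Sum.inl (k p)) (fun _ => Sum.inr PUnit.unit) (e.symm p.1),
        continuous_sumElim_of_continuous (e.symm.continuous.comp (prodFst B T).cont)
          (continuous_inl.comp k.cont) continuous_const⟩, by
        show Sum.elim _ _ (e.symm B.pt) = _
        rw [hpt']; rfl⟩
    have e₁ : (plusLift (ContinuousMap.id W)).comp θ = k := PMap.ext_fun fun p => by
      show Sum.elim _ _ (Sum.elim _ _ (e.symm p.1)) = k p
      rcases hp : e.symm p.1 with y | y
      · rfl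
      · have : p.1 = B.pt := by rw [← hpt, ← e.apply_symm_apply p.1, hp]; rfl
        rw [show p = KProd.mk B.pt p.2 from Prod.ext this rfl, hk]
        rfl
    have e₂ : ε.comp ((plusMap (ContinuousMap.const W PUnit.unit)).comp θ) = prodFst B T :=
      PMap.ext_fun fun p => by
        show e (Sum.elim _ _ (Sum.elim _ _ (e.symm p.1))) = p.1
        refine (congrArg e ?_).trans (e.apply_symm_apply p.1)
        rcases e.symm p.1 with y | y <;> rfl
    have hc : IsConjAct (gpull Γ ε β) η (conjAct (gpull Γ ε β) η) := by
      have := exists_isConjAct hW (gpull Γ ε β) η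
      unfold conjAct
      rw [dif_pos this]
      exact this.choose_spec
    have key := congrArg (gpull Γ θ) hc
    have e₃ : gpull Γ θ (gpull Γ (plusMap (ContinuousMap.const W PUnit.unit)) (gpull Γ ε β)) =
        gpull Γ (prodFst B T) β :=
      (gpull_gpull _ _ _).trans ((gpull_gpull _ _ _).trans (congrArg (fun k => gpull Γ k β) e₂))
    unfold toFox at key
    rw [gpull_mul, gpull_mul, gpull_inv, gpull_gpull, gpull_gpull, e₁] at key
    exact key.trans (congrArg (fun ω => ω * gpull Γ k η * ω⁻¹) e₃)
  -- If `B` is not `S⁰`, then `ΓB` is co-commutative and the conjugation is trivial, in accordance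
  -- with the default value of `dotAct`.
  · have := (h.resolve_right hS).commute_gpull (prodFst B T) (fun _ => rfl) k hk β η
    rw [this.eq, mul_inv_cancel_right]

end Cocommutative

/-! ### A factor split off from a product of three -/

section Split

variable {Γ M B T W Z Z' : PTop.{u}} {X : PTop.{v}}

/-- A homeomorphism of `M` with `B × T`. -/
structure Splitting (M B T : PTop.{u}) where
  /-- the map to the product -/
  toProd : PMap M (prod B T)
  /-- the inverse map -/
  ofProd : PMap (prod B T) M
  ofProd_comp_toProd : ofProd.comp toProd = PMap.id M

/-- The projection of a split space to the split factor. -/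
def Splitting.fst (s : Splitting M B T) : PMap M B := (prodFst B T).comp s.toProd

theorem Splitting.gpull_eq (s : Splitting M B T) (k : PMap M Z) (ζ : HClass (smash Γ Z) X) :
    gpull Γ k ζ = gpull Γ s.toProd (gpull Γ (k.comp s.ofProd) ζ) := by
  rw [gpull_gpull]
  exact congrArg (fun k => gpull Γ k ζ) (congrArg (k.comp ·) s.ofProd_comp_toProd).symm

/-- The map is trivial over the base point of the split factor. -/
def Splitting.Kills (s : Splitting M B T) (k : PMap M Z) : Prop :=
  ∀ t, k (s.ofProd (KProd.mk B.pt t)) = Z.pt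

theorem Splitting.commute_gpull [CoGroup Γ] (s : Splitting M B T)
    (h : HomotopyCocommutative (smash Γ B)) {k : PMap M Z} (hk : s.Kills k) {k' : PMap M Z'}
    (hk' : s.Kills k') (ζ : HClass (smash Γ Z) X) (ζ' : HClass (smash Γ Z') X) :
    Commute (gpull Γ k ζ) (gpull Γ k' ζ') := by
  rw [s.gpull_eq k, s.gpull_eq k']
  exact (h.commute_gpull (k.comp s.ofProd) hk (k'.comp s.ofProd) hk' ζ ζ').map (gpullHom Γ s.toProd)

theorem Splitting.gpull_dotAct [CoGroup Γ] (s : Splitting M B T)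
    (h : HomotopyCocommutative (smash Γ B) ∨ IsS0 B) (hW : HasCGHType W) {k : PMap M W}
    (hk : s.Kills k) (β : HClass (smash Γ B) X) (η : HClass (smash Γ W) X) :
    gpull Γ k (dotAct β η) = gpull Γ s.fst β * gpull Γ k η * (gpull Γ s.fst β)⁻¹ := by
  rw [s.gpull_eq k (dotAct β η), GammaFox.gpull_dotAct h hW (k.comp s.ofProd) hk, gpull_mul, gpull_mul, gpull_inv,
    ← s.gpull_eq, gpull_gpull]
  rfl

/-- The first factor. -/
def split₁ (A B C : PTop.{u}) : Splitting (prod (prod A B) C) A (prod B C) where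
  toProd := prodLift (pr1 A B C) (prodLift (pr2 A B C) (pr3 A B C))
  ofProd := prodLift (prodLift (prodFst _ _) ((prodFst B C).comp (prodSnd _ _)))
    ((prodSnd B C).comp (prodSnd _ _))
  ofProd_comp_toProd := rfl

/-- The second factor. -/
def split₂ (A B C : PTop.{u}) : Splitting (prod (prod A B) C) B (prod A C) where
  toProd := prodLift (pr2 A B C) (prodLift (pr1 A B C) (pr3 A B C))
  ofProd := prodLift (prodLift ((prodFst A C).comp (prodSnd _ _)) (prodFst _ _))
    ((prodSnd A C).comp (prodSnd _ _))
  ofProd_comp_toProd := rfl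

/-- The third factor. -/
def split₃ (A B C : PTop.{u}) : Splitting (prod (prod A B) C) C (prod A B) where
  toProd := prodLift (pr3 A B C) (prodLift (pr1 A B C) (pr2 A B C))
  ofProd := prodLift (prodLift ((prodFst A B).comp (prodSnd _ _))
    ((prodSnd A B).comp (prodSnd _ _))) (prodFst _ _)
  ofProd_comp_toProd := rfl

end Split

/-! ### The Hall-Witt and Jacobi identities for `Γ`-Whitehead products -/

section Identities

variable {Γ A B C : PTop.{u}} [CoGroup Γ] {X : PTop.{v}}

theorem foxWhitehead_hall_witt (hA : HasCGHType A) (hB : HasCGHType B) (hC : HasCGHType C)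
    (α : HClass (smash Γ A) X) (β : HClass (smash Γ B) X) (γ : HClass (smash Γ C) X)
    (a : FoxGroup Γ A X) (b : FoxGroup Γ B X) (c : FoxGroup Γ C X)
    (a' b' c' : FoxGroup Γ (prod (prod A B) C) X)
    (ha : a = toFox Γ (ContinuousMap.id A) α) (hb : b = toFox Γ (ContinuousMap.id B) β)
    (hc : c = toFox Γ (ContinuousMap.id C) γ) (ha' : a' = toFox Γ (pr1 A B C).toMap α)
    (hb' : b' = toFox Γ (pr2 A B C).toMap β) (hc' : c' = toFox Γ (pr3 A B C).toMap γ) :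
    (b' * gpull Γ (plusMap (t213 A B C).toMap) (foxWhitehead (foxWhitehead b⁻¹ a) c) * b'⁻¹) *
      (c' * gpull Γ (plusMap (t321 A B C).toMap) (foxWhitehead (foxWhitehead c⁻¹ b) a) * c'⁻¹) *
      (a' * gpull Γ (plusMap (t132 A B C).toMap) (foxWhitehead (foxWhitehead a⁻¹ c) b) * a'⁻¹) =
        1 := by
  subst ha hb hc
  rw [foxWhitehead_foxWhitehead hB hA hC, foxWhitehead_foxWhitehead hC hB hA,
    foxWhitehead_foxWhitehead hA hC hB]
  simp only [gpull_inv, gpull_plusMap_toFox, gpull_commutator]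
  subst ha' hb' hc'
  exact hall_witt (toFox Γ (pr1 A B C).toMap α) (toFox Γ (pr2 A B C).toMap β)
    (toFox Γ (pr3 A B C).toMap γ)

/-- After pulling back to the product, each required commutation holds because the two classes are
both trivial over the base point of a common factor with co-commutative suspension `Γ ∧ -`. -/
theorem gammaWhitehead_jacobi (hA : HasCGHType A) (hB : HasCGHType B) (hC : HasCGHType C)
    (α : HClass (smash Γ A) X) (β : HClass (smash Γ B) X) (γ : HClass (smash Γ C) X)
    (cA : HomotopyCocommutative (smash Γ A)) (cB : HomotopyCocommutative (smash Γ B))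
    (cC : HomotopyCocommutative (smash Γ C)) :
    gammaWhitehead (gammaWhitehead α β) γ *
      gpull Γ (s312 A B C) (gammaWhitehead (gammaWhitehead γ α) β) *
      gpull Γ (s231 A B C) (gammaWhitehead (gammaWhitehead β γ) α) = 1 := by
  let a := gpull Γ (pr1 A B C) α
  let b := gpull Γ (pr2 A B C) β
  let c := gpull Γ (pr3 A B C) γ
  let k₁ := smash3Mk A B C
  let k₂ := (smash3Mk C A B).comp (t312 A B C)
  let k₃ := (smash3Mk B C A).comp (t231 A B C)
  let l₁ := (smashMk A B).comp (prodLift (pr1 A B C) (pr2 A B C))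
  let l₂ := (smashMk C A).comp (prodLift (pr3 A B C) (pr1 A B C))
  let l₃ := (smashMk B C).comp (prodLift (pr2 A B C) (pr3 A B C))
  have e₁ : gpull Γ k₁ (gammaWhitehead (gammaWhitehead α β) γ) = ⁅⁅a, b⁆, c⁆ :=
    gpull_smash3Mk_gammaWhitehead hA hB hC α β γ
  have e₂ : gpull Γ k₂ (gammaWhitehead (gammaWhitehead γ α) β) = ⁅⁅c, a⁆, b⁆ := by
    rw [← gpull_gpull, gpull_smash3Mk_gammaWhitehead hC hA hB]
    simp only [gpull_commutator, gpull_gpull]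
    rfl
  have e₃ : gpull Γ k₃ (gammaWhitehead (gammaWhitehead β γ) α) = ⁅⁅b, c⁆, a⁆ := by
    rw [← gpull_gpull, gpull_smash3Mk_gammaWhitehead hB hC hA]
    simp only [gpull_commutator, gpull_gpull]
    rfl
  have f₁ : gpull Γ l₁ (gammaWhitehead α β) = ⁅a, b⁆ := by
    rw [← gpull_gpull, gpull_smashMk_gammaWhitehead hA hB]
    simp only [gpull_commutator, gpull_gpull]
    rfl
  have f₂ : gpull Γ l₂ (gammaWhitehead γ α) = ⁅c, a⁆ := by
    rw [← gpull_gpull, gpull_smashMk_gammaWhitehead hC hA]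
    simp only [gpull_commutator, gpull_gpull]
    rfl
  have f₃ : gpull Γ l₃ (gammaWhitehead β γ) = ⁅b, c⁆ := by
    rw [← gpull_gpull, gpull_smashMk_gammaWhitehead hB hC]
    simp only [gpull_commutator, gpull_gpull]
    rfl
  have p₁ : (split₁ A B C).Kills (pr1 A B C) := fun _ => rfl
  have p₂ : (split₂ A B C).Kills (pr2 A B C) := fun _ => rfl
  have p₃ : (split₃ A B C).Kills (pr3 A B C) := fun _ => rfl
  have m₁ : (split₂ A B C).Kills l₁ := fun _ => smashMk_eq_pt (Or.inr rfl)
  have m₂ : (split₁ A B C).Kills l₂ := fun _ => smashMk_eq_pt (Or.inr rfl)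
  have m₃ : (split₃ A B C).Kills l₃ := fun _ => smashMk_eq_pt (Or.inr rfl)
  have n₁ : (split₂ A B C).Kills k₁ := fun _ => smash3Mk_eq_pt (Or.inr (Or.inl rfl))
  have n₂ : (split₁ A B C).Kills k₂ := fun _ => smash3Mk_eq_pt (Or.inr (Or.inl rfl))
  have n₃ : (split₃ A B C).Kills k₃ := fun _ => smash3Mk_eq_pt (Or.inr (Or.inl rfl))
  have n₂' : (split₂ A B C).Kills k₂ := fun _ => smash3Mk_eq_pt (Or.inr (Or.inr rfl))
  have n₃' : (split₂ A B C).Kills k₃ := fun _ => smash3Mk_eq_pt (Or.inl rfl)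
  refine gpull_smash3Mk_injective hA hB hC ?_
  rw [gpull_mul, gpull_mul, gpull_gpull, gpull_gpull, gpull_one]
  show gpull Γ k₁ _ * gpull Γ k₂ _ * gpull Γ k₃ _ = 1
  rw [e₁, e₂, e₃]
  refine jacobi_of_commute ?_ ?_ ?_ ?_ ?_ ?_ ?_
  · rw [← f₁]; exact (split₂ A B C).commute_gpull cB p₂ m₁ _ _
  · rw [← f₃]; exact (split₃ A B C).commute_gpull cC p₃ m₃ _ _
  · rw [← f₂]; exact (split₁ A B C).commute_gpull cA p₁ m₂ _ _
  · rw [← e₁]; exact (split₂ A B C).commute_gpull cB p₂ n₁ _ _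
  · rw [← e₃]; exact (split₃ A B C).commute_gpull cC p₃ n₃ _ _
  · rw [← e₂]; exact (split₁ A B C).commute_gpull cA p₁ n₂ _ _
  -- Both threefold products vanish over the base point of each factor; splitting off `B` is one
  -- choice among three.
  · rw [← e₂, ← e₃]; exact (split₂ A B C).commute_gpull cB n₂' n₃' _ _

/-- `dotAct` is made so that over the product it is conjugation in either case, which leaves
precisely the Hall-Witt identity. -/
theorem gammaWhitehead_hall_witt (hA : HasCGHType A) (hB : HasCGHType B) (hC : HasCGHType C)
    (α : HClass (smash Γ A) X) (β : HClass (smash Γ B) X) (γ : HClass (smash Γ C) X)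
    (cA : HomotopyCocommutative (smash Γ A) ∨ IsS0 A)
    (cB : HomotopyCocommutative (smash Γ B) ∨ IsS0 B)
    (cC : HomotopyCocommutative (smash Γ C) ∨ IsS0 C) :
    gpull Γ (s213 A B C) (dotAct β (gammaWhitehead (gammaWhitehead β⁻¹ α) γ)) *
      gpull Γ (s321 A B C) (dotAct γ (gammaWhitehead (gammaWhitehead γ⁻¹ β) α)) *
      gpull Γ (s132 A B C) (dotAct α (gammaWhitehead (gammaWhitehead α⁻¹ γ) β)) = 1 := by
  let k₁ := (smash3Mk B A C).comp (t213 A B C)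
  let k₂ := (smash3Mk C B A).comp (t321 A B C)
  let k₃ := (smash3Mk A C B).comp (t132 A B C)
  have n₁ : (split₂ A B C).Kills k₁ := fun _ => smash3Mk_eq_pt (Or.inl rfl)
  have n₂ : (split₃ A B C).Kills k₂ := fun _ => smash3Mk_eq_pt (Or.inl rfl)
  have n₃ : (split₁ A B C).Kills k₃ := fun _ => smash3Mk_eq_pt (Or.inl rfl)
  refine gpull_smash3Mk_injective hA hB hC ?_
  rw [gpull_mul, gpull_mul, gpull_gpull, gpull_gpull, gpull_gpull, gpull_one]
  show gpull Γ k₁ _ * gpull Γ k₂ _ * gpull Γ k₃ _ = 1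
  rw [(split₂ A B C).gpull_dotAct cB (hasCGHType_smash (hasCGHType_smash hB hA) hC) n₁,
    (split₃ A B C).gpull_dotAct cC (hasCGHType_smash (hasCGHType_smash hC hB) hA) n₂,
    (split₁ A B C).gpull_dotAct cA (hasCGHType_smash (hasCGHType_smash hA hC) hB) n₃]
  simp only [k₁, k₂, k₃]
  rw [← gpull_gpull, ← gpull_gpull, ← gpull_gpull, gpull_smash3Mk_gammaWhitehead hB hA hC,
    gpull_smash3Mk_gammaWhitehead hC hB hA, gpull_smash3Mk_gammaWhitehead hA hC hB]
  simp only [gpull_commutator, gpull_inv, gpull_gpull]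
  exact hall_witt (gpull Γ (pr1 A B C) α) (gpull Γ (pr2 A B C) β) (gpull Γ (pr3 A B C) γ)

end Identities

end GammaFox

theorem theorem4 (Γ A B C : PTop.{u}) [CoGroup Γ] (X : PTop.{v})
    (hA : HasCGHType A) (hB : HasCGHType B) (hC : HasCGHType C)
    (α : HClass (smash Γ A) X) (β : HClass (smash Γ B) X) (γ : HClass (smash Γ C) X) :
    -- the `Γ`-Whitehead products and the action of `[Γ, X]` are well defined
    ((∀ P Q : PTop.{u}, HasCGHType P → HasCGHType Q → HasCGHType (smash P Q) ∧
        ∀ (μ : HClass (smash Γ P) X) (ν : HClass (smash Γ Q) X), ∃! κ, IsGammaWhitehead μ ν κ) ∧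
      ∀ W : PTop.{u}, HasCGHType W →
        ∀ (ξ : HClass (smash Γ S0) X) (η : HClass (smash Γ W) X), ∃! ζ, IsConjAct ξ η ζ) ∧
    -- (1) the Hall-Witt form in `τ^Γ_{A × B × C}(X)`, where the iterated `Γ`-Whitehead products
    -- of the images of `α, β, γ` are the images of the iterated `Γ`-Whitehead products
    (∀ (a : FoxGroup Γ A X) (b : FoxGroup Γ B X) (c : FoxGroup Γ C X)
        (a' b' c' : FoxGroup Γ (prod (prod A B) C) X),
        a = toFox Γ (ContinuousMap.id A) α → b = toFox Γ (ContinuousMap.id B) β →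
        c = toFox Γ (ContinuousMap.id C) γ →
        a' = toFox Γ (pr1 A B C).toMap α → b' = toFox Γ (pr2 A B C).toMap β →
        c' = toFox Γ (pr3 A B C).toMap γ →
        (b' * gpull Γ (plusMap (t213 A B C).toMap) (foxWhitehead (foxWhitehead b⁻¹ a) c) * b'⁻¹) *
          (c' * gpull Γ (plusMap (t321 A B C).toMap) (foxWhitehead (foxWhitehead c⁻¹ b) a) *
            c'⁻¹) *
          (a' * gpull Γ (plusMap (t132 A B C).toMap) (foxWhitehead (foxWhitehead a⁻¹ c) b) *
            a'⁻¹) = 1 ∧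
        foxWhitehead (foxWhitehead b⁻¹ a) c =
          toFox Γ (smash3Mk B A C).toMap (gammaWhitehead (gammaWhitehead β⁻¹ α) γ) ∧
        foxWhitehead (foxWhitehead c⁻¹ b) a =
          toFox Γ (smash3Mk C B A).toMap (gammaWhitehead (gammaWhitehead γ⁻¹ β) α) ∧
        foxWhitehead (foxWhitehead a⁻¹ c) b =
          toFox Γ (smash3Mk A C B).toMap (gammaWhitehead (gammaWhitehead α⁻¹ γ) β)) ∧
    -- (2) the Jacobi identity (the group operation is written multiplicatively)
    (HomotopyCocommutative (smash Γ A) → HomotopyCocommutative (smash Γ B) →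
      HomotopyCocommutative (smash Γ C) →
        gammaWhitehead (gammaWhitehead α β) γ *
          gpull Γ (s312 A B C) (gammaWhitehead (gammaWhitehead γ α) β) *
          gpull Γ (s231 A B C) (gammaWhitehead (gammaWhitehead β γ) α) = 1) ∧
    -- (3) the mixed form
    (HomotopyCocommutative (smash Γ A) ∨ IsS0 A → HomotopyCocommutative (smash Γ B) ∨ IsS0 B →
      HomotopyCocommutative (smash Γ C) ∨ IsS0 C →
        gpull Γ (s213 A B C) (dotAct β (gammaWhitehead (gammaWhitehead β⁻¹ α) γ)) *
          gpull Γ (s321 A B C) (dotAct γ (gammaWhitehead (gammaWhitehead γ⁻¹ β) α)) *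
          gpull Γ (s132 A B C) (dotAct α (gammaWhitehead (gammaWhitehead α⁻¹ γ) β)) = 1) := by
  refine ⟨⟨fun P Q hP hQ => ⟨hasCGHType_smash hP hQ, fun μ ν =>
    existsUnique_isGammaWhitehead hP hQ μ ν⟩, fun W hW ξ η => existsUnique_isConjAct hW ξ η⟩,
    fun a b c a' b' c' ha hb hc ha' hb' hc' => ⟨foxWhitehead_hall_witt hA hB hC α β γ a b c a' b' c'
      ha hb hc ha' hb' hc', ?_⟩, gammaWhitehead_jacobi hA hB hC α β γ,
    gammaWhitehead_hall_witt hA hB hC α β γ⟩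
  subst ha hb hc
  simp only [← toFox_inv]
  exact ⟨foxWhitehead_toFox hB hA hC _ _ _, foxWhitehead_toFox hC hB hA _ _ _,
    foxWhitehead_toFox hA hC hB _ _ _⟩
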